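/- Let $\Bbbk$ be any commutative ring and let $n \geqslant 2$. Let $\vec{\mathbb{A}}_n$ be the quiver with vertices $1,\ldots,n$ and one arrow $a_q\colon q \to q+1$ for each $1 \leqslant q < n$, and let $\Gamma$ be its double quiver, obtained by adding an arrow $a_q^*\colon q+1 \to q$ for each $1 \leqslant q<n$. Let $Q$ be the mesh category of $\Gamma$ over $\Bbbk$: the quotient of the path category $\Bbbk\Gamma$ (objects the vertices, $\Bbbk\Gamma(p,q)$ the free $\Bbbk$-module on the paths from $p$ to $q$) by the two-sided ideal generated by the mesh relations $$\mu_q \,=\, a_{q-1}a_{q-1}^* + a_q^*a_q \qquad (1 \leqslant q \leqslant n),$$ where a summand involving the non-existing arrows $a_0,a_0^*$ or $a_n,a_n^*$ is omitted. Then the following assertions hold. (1) (Hom-finiteness and local boundedness) Every $\Bbbk$-module $Q(p,q)$ is finitely generated and projective, and for every $q$ there are only finitely many $p$ with $Q(p,q)\neq 0$ and only finitely many $r$ with $Q(q,r) \neq 0$. More precisely, every $Q(p,q)$ is a free $\Bbbk$-module with a basis of $\min\{p,\,q,\,n+1-p,\,n+1-q\}$ elements. (2) (Serre functor) There is a unique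 $\Bbbk$-linear functor $\mathbb{S}\colon Q \to Q$ with $\mathbb{S}(q)=n+1-q$ on objects and $$\mathbb{S}(a_q) = (-1)^q\,a^*_{n-q} \qquad\text{and}\qquad \mathbb{S}(a^*_q) = (-1)^{n-q}\,a_{n-q} \qquad (1 \leqslant q<n),$$ and $\mathbb{S}$ is a Serre functor relative to $\Bbbk$, that is, $\mathbb{S}$ is an autoequivalence of $Q$ and there are isomorphisms of $\Bbbk$-modules $Q(p,q) \cong \operatorname{Hom}_{\Bbbk}(Q(q,\mathbb{S}(p)),\Bbbk)$ natural in $p$ and $q$. (3) (Strong Retraction Property) For every $q$ the unit map $\Bbbk \to Q(q,q)$, $x \mapsto x\cdot\mathrm{id}_q$, has a $\Bbbk$-linear retraction, and there are $\Bbbk$-submodules $\mathfrak{r}_q \subseteq Q(q,q)$ with $Q(q,q) = (\Bbbk\cdot\mathrm{id}_q)\oplus\mathfrak{r}_q$ such that $\mathfrak{r}_q\circ\mathfrak{r}_q \subseteq \mathfrak{r}_q$ for all $q$ and $Q(q,p)\circ Q(p,q) \subseteq \mathfrak{r}_p$ for all $p \neq q$. In fact, if $\mathfrak{r}$ denotes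 the arrow ideal, i.e. the two-sided ideal of $Q$ generated by all the arrows $a_q$ and $a_q^*$, then $\mathfrak{r}_q = \mathfrak{r}(q,q)$ is such a choice, and $\mathfrak{r}(p,q)=Q(p,q)$ for all $p\neq q$ (so $\mathfrak{r}$ is the corresponding pseudo-radical of $Q$). (4) The arrow ideal is nilpotent; in fact, $\mathfrak{r}^n=0$. -/

import Mathlib

open CategoryTheory

universe w v u

/-! ### Ideals in `k`-linear categories -/

/-- A two-sided ideal in a `k`-linear category: a family of `k`-submodules of the Hom-modules
closed under composition with arbitrary morphisms on either side. -/
@[ext]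
structure LinearIdeal (k : Type w) [CommRing k] (C : Type u) [Category.{v} C] [Preadditive C]
    [Linear k C] where
  /-- the submodule of morphisms `p ⟶ q` that belong to the ideal -/
  hom : ∀ p q : C, Submodule k (p ⟶ q)
  precomp : ∀ {p q r : C} (f : p ⟶ q) {g : q ⟶ r}, g ∈ hom q r → f ≫ g ∈ hom p r
  postcomp : ∀ {p q r : C} {f : p ⟶ q} (g : q ⟶ r), f ∈ hom p q → f ≫ g ∈ hom p r

namespace LinearIdeal

variable {k : Type w} [CommRing k] {C : Type u} [Category.{v} C] [Preadditive C] [Linear k C]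

/-- The ideal generated by a class `W` of morphisms: its morphisms are the `k`-linear combinations
of composites `f ≫ s ≫ g` with `s` in `W`. -/
def generate (k : Type w) [CommRing k] {C : Type u} [Category.{v} C] [Preadditive C] [Linear k C]
    (W : MorphismProperty C) : LinearIdeal k C where
  hom p q := Submodule.span k
    {h | ∃ (x y : C) (f : p ⟶ x) (s : x ⟶ y) (g : y ⟶ q), W s ∧ h = f ≫ s ≫ g}
  precomp {p q r} f g hg := by
    refine (Submodule.span_le (p := (Submodule.span k _).comap (Linear.leftComp k r f))).2 ?_ hg
    rintro _ ⟨x, y, f', s, g', hs, rfl⟩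
    exact Submodule.subset_span ⟨x, y, f ≫ f', s, g', hs, by simp⟩
  postcomp {p q r} f g hf := by
    refine (Submodule.span_le (p := (Submodule.span k _).comap (Linear.rightComp k p g))).2 ?_ hf
    rintro _ ⟨x, y, f', s, g', hs, rfl⟩
    exact Submodule.subset_span ⟨x, y, f', s, g' ≫ g, hs, by simp⟩

/-- The unit ideal, consisting of all morphisms. -/
def unit (k : Type w) [CommRing k] (C : Type u) [Category.{v} C] [Preadditive C] [Linear k C] :
    LinearIdeal k C where
  hom _ _ := ⊤
  precomp _ _ _ := trivial
  postcomp _ _ := trivial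

/-- The product of two ideals: linear combinations of composites of a morphism in the first ideal
followed by a morphism in the second ideal. -/
def mul (I J : LinearIdeal k C) : LinearIdeal k C where
  hom p q := Submodule.span k
    {h | ∃ (x : C) (f : p ⟶ x) (g : x ⟶ q), f ∈ I.hom p x ∧ g ∈ J.hom x q ∧ h = f ≫ g}
  precomp {p q r} f g hg := by
    refine (Submodule.span_le (p := (Submodule.span k _).comap (Linear.leftComp k r f))).2 ?_ hg
    rintro _ ⟨x, f', g', hf, hg, rfl⟩
    exact Submodule.subset_span ⟨x, f ≫ f', g', I.precomp f hf, hg, by simp⟩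
  postcomp {p q r} f g hf := by
    refine (Submodule.span_le (p := (Submodule.span k _).comap (Linear.rightComp k p g))).2 ?_ hf
    rintro _ ⟨x, f', g', hf, hg, rfl⟩
    exact Submodule.subset_span ⟨x, f', g' ≫ g, hf, J.postcomp g hg, by simp⟩

/-- Powers of an ideal. -/
def pow (I : LinearIdeal k C) : ℕ → LinearIdeal k C
  | 0 => unit k C
  | m + 1 => (I.pow m).mul I

/-- The congruence attached to an ideal: `f` and `g` are identified when `f - g` lies in it. -/
def rel (I : LinearIdeal k C) : HomRel C := fun p q f g => f - g ∈ I.hom p q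

instance congruence_rel (I : LinearIdeal k C) : Congruence I.rel where
  comp_left f _ _ h := by
    have := I.precomp f h
    rwa [Preadditive.comp_sub] at this
  comp_right g h := by
    have := I.postcomp g h
    rwa [Preadditive.sub_comp] at this
  equivalence {p q} :=
    { refl := fun f => by
        change f - f ∈ I.hom p q
        simp
      symm := fun {f g} h => by
        change g - f ∈ I.hom p q
        rw [← neg_sub]
        exact Submodule.neg_mem _ h
      trans := fun {f g h} h₁ h₂ => by
        change f - h ∈ I.hom p q
        rw [← sub_add_sub_cancel f g h]
        exact Submodule.add_mem _ h₁ h₂ }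

theorem rel_add (I : LinearIdeal k C) ⦃p q : C⦄ (f₁ f₂ g₁ g₂ : p ⟶ q) (hf : I.rel f₁ f₂)
    (hg : I.rel g₁ g₂) : I.rel (f₁ + g₁) (f₂ + g₂) := by
  change f₁ + g₁ - (f₂ + g₂) ∈ I.hom p q
  rw [add_sub_add_comm]
  exact Submodule.add_mem _ hf hg

theorem rel_smul (I : LinearIdeal k C) (a : k) ⦃p q : C⦄ (f₁ f₂ : p ⟶ q) (hf : I.rel f₁ f₂) :
    I.rel (a • f₁) (a • f₂) := by
  change a • f₁ - a • f₂ ∈ I.hom p q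
  rw [← smul_sub]
  exact Submodule.smul_mem _ a hf

/-- The quotient category `C / I`. -/
abbrev QuotientCategory (I : LinearIdeal k C) : Type u := CategoryTheory.Quotient I.rel

instance quotientPreadditive (I : LinearIdeal k C) : Preadditive I.QuotientCategory :=
  CategoryTheory.Quotient.preadditive I.rel I.rel_add

instance quotientFunctor_additive (I : LinearIdeal k C) :
    (CategoryTheory.Quotient.functor I.rel).Additive :=
  CategoryTheory.Quotient.functor_additive I.rel I.rel_add

instance quotientLinear (I : LinearIdeal k C) : Linear k I.QuotientCategory :=
  CategoryTheory.Quotient.linear k I.rel I.rel_smul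

end LinearIdeal

/-! ### Properties of `k`-linear categories -/

section Properties

variable (k : Type w) [CommRing k] (C : Type u) [Category.{v} C] [Preadditive C] [Linear k C]

/-- Hom-finiteness: every Hom-module is finitely generated and projective. -/
def IsHomFinite : Prop :=
  ∀ p q : C, Module.Finite k (p ⟶ q) ∧ Module.Projective k (p ⟶ q)

/-- Local boundedness: every object has only finitely many objects mapping nontrivially
into it or out of it. -/
def IsLocallyBounded (C : Type u) [Category.{v} C] [Preadditive C] : Prop :=
  ∀ q : C, {p : C | ∃ f : p ⟶ q, f ≠ 0}.Finite ∧ {r : C | ∃ f : q ⟶ r, f ≠ 0}.Finite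

variable {C}

/-- `S` is a Serre functor relative to `k`: a `k`-linear autoequivalence together with
`k`-linear isomorphisms `C(p, q) ≅ Hom_k (C(q, S p), k)` natural in `p` and `q`. -/
structure IsSerreFunctor (S : C ⥤ C) : Prop where
  additive : S.Additive
  linear : S.Linear k
  isEquivalence : S.IsEquivalence
  exists_natural_iso :
    ∃ φ : ∀ p q : C, (p ⟶ q) ≃ₗ[k] Module.Dual k (q ⟶ S.obj p),
      (∀ {p q q' : C} (f : p ⟶ q) (β : q ⟶ q') (g : q' ⟶ S.obj p),
        φ p q' (f ≫ β) g = φ p q f (β ≫ g)) ∧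
      (∀ {p' p q : C} (α : p' ⟶ p) (f : p ⟶ q) (g : q ⟶ S.obj p'),
        φ p' q (α ≫ f) g = φ p q f (g ≫ S.map α))

/-- A family of complements `r q` of `k · 𝟙 q` in `C(q, q)` that is compatible with composition,
where each unit map `k → C(q, q)` has a `k`-linear retraction. -/
structure IsCompatibleComplement (r : ∀ q : C, Submodule k (q ⟶ q)) : Prop where
  retraction : ∀ q : C, ∃ ρ : (q ⟶ q) →ₗ[k] k, ∀ x : k, ρ (x • 𝟙 q) = x
  isCompl : ∀ q : C, IsCompl (Submodule.span k {𝟙 q}) (r q)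
  comp_mem : ∀ (q : C) (f g : q ⟶ q), f ∈ r q → g ∈ r q → f ≫ g ∈ r q
  comp_mem_of_ne : ∀ (p q : C), p ≠ q → ∀ (f : p ⟶ q) (g : q ⟶ p), f ≫ g ∈ r p

variable (C) in
/-- The Strong Retraction Property. -/
def StrongRetractionProperty : Prop :=
  ∃ r : ∀ q : C, Submodule k (q ⟶ q), IsCompatibleComplement k r

variable {k} in
/-- `I` is the pseudo-radical attached to some choice of complements in the Strong Retraction
Property: `I(q, q)` is the chosen complement at `q`, and `I(p, q) = C(p, q)` for `p ≠ q`. -/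
structure LinearIdeal.IsPseudoRadical (I : LinearIdeal k C) : Prop where
  isCompatibleComplement : IsCompatibleComplement k fun q => I.hom q q
  eq_top_of_ne : ∀ p q : C, p ≠ q → I.hom p q = ⊤

end Properties

/-! ### Stable translation quivers and their mesh categories -/

/-- A (locally finite) stable translation quiver. The semitranslation, a bijection on the set of
all arrows sending an arrow `p ⟶ q` to an arrow `τ q ⟶ p`, is given by its restrictions, which are
bijections because the translation `τ` is one. -/
class StableTranslationQuiver (V : Type u) [Quiver.{v} V] where
  /-- the translation -/
  τ : V ≃ V
  /-- the semitranslation -/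
  σ : ∀ {p q : V}, (p ⟶ q) ≃ (τ q ⟶ p)
  /-- every vertex is the target of only finitely many arrows -/
  finite_costar : ∀ q : V, Finite (Quiver.Costar q)

noncomputable section

/-- The path category: objects are the vertices, and the module of morphisms from `p` to `q` is
free on the set of paths from `p` to `q`. -/
abbrev PathCategory (k : Type w) (V : Type u) : Type u := Free k (Paths V)

section Mesh

variable (k : Type w) [CommRing k] {V : Type u} [Quiver.{v} V]

/-- A vertex, as an object of the path category. -/
def pathObj (q : V) : PathCategory k V := (Free.embedding k (Paths V)).obj ((Paths.of V).obj q)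

/-- An arrow, as a morphism of the path category. -/
def pathArrow {p q : V} (a : p ⟶ q) : pathObj k p ⟶ pathObj k q :=
  (Free.embedding k (Paths V)).map ((Paths.of V).map a)

variable [StableTranslationQuiver V]

/-- The mesh relation at `q`: the sum, over all arrows `a` with target `q`, of the path
`σ a` followed by `a`. -/
def meshRelation (q : V) : pathObj k (StableTranslationQuiver.τ q) ⟶ pathObj k q :=
  ∑ᶠ a : Quiver.Costar q, pathArrow k (StableTranslationQuiver.σ a.2) ≫ pathArrow k a.2

variable (V) in
/-- The mesh ideal of the path category. -/
def meshIdeal : LinearIdeal k (PathCategory k V) :=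
  LinearIdeal.generate k (MorphismProperty.ofHoms fun q : V => meshRelation k q)

variable (V) in
/-- The mesh category: the quotient of the path category by the mesh ideal. -/
abbrev MeshCategory : Type u := (meshIdeal k V).QuotientCategory

/-- A vertex, as an object of the mesh category. -/
def meshObj (q : V) : MeshCategory k V :=
  (CategoryTheory.Quotient.functor (meshIdeal k V).rel).obj (pathObj k q)

/-- An arrow, as a morphism of the mesh category. -/
def meshArrow {p q : V} (a : p ⟶ q) : meshObj k p ⟶ meshObj k q :=
  (CategoryTheory.Quotient.functor (meshIdeal k V).rel).map (pathArrow k a)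

variable (V) in
/-- The arrow ideal of the mesh category: the ideal generated by all arrows. -/
def arrowIdeal : LinearIdeal k (MeshCategory k V) :=
  LinearIdeal.generate k
    (MorphismProperty.ofHoms fun a : (Σ p q : V, p ⟶ q) => meshArrow k a.2.2)

end Mesh

/-- The double quiver of a quiver with finitely many arrows at each vertex is a stable translation
quiver: the translation is the identity and the semitranslation exchanges `x` and `x*`. In
`Quiver.Symmetrify U` the arrow `x` is `Sum.inl x` and `x*` is `Sum.inr x`. -/
instance doubleStableTranslationQuiver (U : Type u) [Quiver.{v} U] [hs : ∀ q : U, Finite (Quiver.Star q)]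
    [hc : ∀ q : U, Finite (Quiver.Costar q)] : StableTranslationQuiver (Quiver.Symmetrify U) where
  τ := Equiv.refl _
  σ {p q} := Equiv.sumComm (@Quiver.Hom U _ p q) (@Quiver.Hom U _ q p)
  finite_costar q := by
    let e : (Quiver.Costar (U := U) q) ⊕ (Quiver.Star (U := U) q) →
        (Quiver.Costar (U := Quiver.Symmetrify U) q) :=
      Sum.elim (fun a => ⟨a.1, Sum.inl a.2⟩) (fun a => ⟨a.1, Sum.inr a.2⟩)
    have := hs q
    have := hc q
    refine Finite.of_surjective e ?_
    rintro ⟨p, a | a⟩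
    · exact ⟨Sum.inl ⟨p, a⟩, rfl⟩
    · exact ⟨Sum.inr ⟨p, a⟩, rfl⟩

/-! ### The linearly oriented quiver of type `A_n` -/

/-- The vertices `1, …, n` of the quiver `A_n`. -/
@[ext]
structure AVertex (n : ℕ) where
  /-- the number of the vertex -/
  val : ℕ
  one_le : 1 ≤ val
  le : val ≤ n

/-- Linear orientation: there is exactly one arrow `p ⟶ q` if `q = p + 1`, and none otherwise. -/
instance AVertex.quiver (n : ℕ) : Quiver (AVertex n) where
  Hom p q := PLift (p.val + 1 = q.val)

instance AVertex.finite (n : ℕ) : Finite (AVertex n) :=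
  Finite.of_injective (fun q : AVertex n => (⟨q.val, Nat.lt_succ_of_le q.le⟩ : Fin (n + 1)))
    fun _ _ h => AVertex.ext (congrArg Fin.val h)

instance AVertex.finite_star (n : ℕ) (q : AVertex n) : Finite (Quiver.Star q) :=
  inferInstanceAs (Finite (Σ p : AVertex n, PLift (q.val + 1 = p.val)))

instance AVertex.finite_costar (n : ℕ) (q : AVertex n) : Finite (Quiver.Costar q) :=
  inferInstanceAs (Finite (Σ p : AVertex n, PLift (p.val + 1 = q.val)))

namespace AVertex

/-- The vertex `n + 1 - q`. -/
def rev {n : ℕ} (q : AVertex n) : AVertex n where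
  val := n + 1 - q.val
  one_le := by have := q.le; omega
  le := by have := q.one_le; omega

theorem rev_succ {n : ℕ} {p q : AVertex n} (h : p.val + 1 = q.val) :
    q.rev.val + 1 = p.rev.val := by
  have := q.le
  change n + 1 - q.val + 1 = n + 1 - p.val
  omega

end AVertex

/-- The mesh category over `k` of the double quiver of the linearly oriented quiver `A_n`. -/
abbrev MeshDoubleA (k : Type w) [CommRing k] (n : ℕ) : Type :=
  MeshCategory k (Quiver.Symmetrify (AVertex n))

namespace MeshDoubleA

variable (k : Type w) [CommRing k] {n : ℕ}

/-- The vertex `q`, as an object of the mesh category. -/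
def obj (q : AVertex n) : MeshDoubleA k n := meshObj k (V := Quiver.Symmetrify (AVertex n)) q

/-- The arrow `a_p : p ⟶ q`, where `q = p + 1`, in the mesh category. -/
def a {p q : AVertex n} (h : p.val + 1 = q.val) : obj k p ⟶ obj k q :=
  meshArrow k (V := Quiver.Symmetrify (AVertex n)) (Sum.inl (PLift.up h))

/-- The arrow `(a_p)* : q ⟶ p`, where `q = p + 1`, in the mesh category. -/
def aStar {p q : AVertex n} (h : p.val + 1 = q.val) : obj k q ⟶ obj k p :=
  meshArrow k (V := Quiver.Symmetrify (AVertex n)) (Sum.inr (PLift.up h))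

/-- The formulae `S q = n + 1 - q`, `S a_p = (-1)^p (a_{n-p})*` and `S (a_p)* = (-1)^(n-p) a_{n-p}`.
For an arrow `a_p : p ⟶ q` with `q = p + 1`, the arrow `a_{n-p}` goes from `n + 1 - q = n - p` to
`n + 1 - p`. -/
structure SerreFormulae (S : MeshDoubleA k n ⥤ MeshDoubleA k n) : Prop where
  obj_eq : ∀ q : AVertex n, S.obj (obj k q) = obj k q.rev
  map_a : ∀ {p q : AVertex n} (h : p.val + 1 = q.val),
    S.map (a k h) = eqToHom (obj_eq p) ≫
      ((-1 : k) ^ p.val • aStar k (AVertex.rev_succ h)) ≫ eqToHom (obj_eq q).symm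
  map_aStar : ∀ {p q : AVertex n} (h : p.val + 1 = q.val),
    S.map (aStar k h) = eqToHom (obj_eq q) ≫
      ((-1 : k) ^ (n - p.val) • a k (AVertex.rev_succ h)) ≫ eqToHom (obj_eq p).symm

end MeshDoubleA

end

/-! Morphisms of the mesh category behave like truncated polynomials. Give `a_p` weight 1 and
`(a_p)*` weight `(-1)^p X`, and multiply along paths. At an inner vertex the two summands of the
mesh relation have opposite weights. At the end vertices 1 and `n` a single summand of weight `±X`
survives, but a path from `p` to 1 already has at least `p - 1` downward arrows, and a path from `n`
to `q` at least `n - q`. Hence the coefficient of `X^d` is well defined on `Q(p, q)` for `d < min(p,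
n + 1 - q)` (`coeff_weight_mesh`), and it vanishes for `d < p - q`.

Conversely, with `b_p = (-1)^p (a_p)*` the mesh relations say that the `a`'s and `b`'s commute at
inner vertices, and that the composites `ab` at 1 and `ba` at `n` are zero. So every path is, up to
sign, a normal form with some number `d` of downward arrows, which is zero for `d` outside the range
above (`normalPath_of_le_target`). The coefficients separate the remaining normal forms, so these
are a basis (`sum_coeff_smul_normalPath`, `basis`), and composition is truncated multiplication
(`coeff_comp`).

The rest is read off from coefficients. The degree `2d + q - p` is path length and is at most `n -
1` on basis elements, which makes the arrow ideal nilpotent. The functor exchanging `a` and `b` up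
to `(-1)^n` is an involution, and the top coefficient on `Q(p, n + 1 - p)`, suitably signed, is a
trace twisted by it (`trace_comp`) whose pairing is perfect, because the normal forms of degrees `d`
and `p - 1 - d` are dual to each other. -/

/-! ### Polynomial weights on the path category. -/

open Polynomial in
/-- The weight of an arrow: `1` for `a_p`, and `(-1)^p X` for `(a_p)*`. -/
noncomputable def AVertex.arrowWeight (k : Type w) [CommRing k] {n : ℕ}
    {p q : Quiver.Symmetrify (AVertex n)} (e : p ⟶ q) : k[X] :=
  Sum.elim (fun _ => 1) (fun _ => C ((-1) ^ AVertex.val q) * X) e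

open Polynomial in
/-- The weight of a path, the product of the weights of its arrows. -/
noncomputable def AVertex.pathWeight (k : Type w) [CommRing k] {n : ℕ}
    {p : Quiver.Symmetrify (AVertex n)} :
    {q : Quiver.Symmetrify (AVertex n)} → Quiver.Path p q → k[X]
  | _, .nil => 1
  | _, .cons w e => AVertex.pathWeight k w * AVertex.arrowWeight k e

namespace MeshDoubleA

open Polynomial

variable (k : Type w) [CommRing k] {n : ℕ}

open AVertex

theorem pathWeight_comp {p q r : Quiver.Symmetrify (AVertex n)} (v : Quiver.Path p q)
    (w : Quiver.Path q r) : pathWeight k (v.comp w) = pathWeight k v * pathWeight k w := by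
  induction w with
  | nil => simp [pathWeight]
  | cons w e ih => simp [pathWeight, ih, mul_assoc]

/-- The number of downward arrows of a path determines its weight up to sign. -/
theorem exists_pathWeight_eq {p q : Quiver.Symmetrify (AVertex n)} (w : Quiver.Path p q) :
    ∃ (s : k) (d : ℕ), AVertex.val p ≤ AVertex.val q + d ∧ pathWeight k w = C s * X ^ d := by
  induction w with
  | nil => exact ⟨1, 0, by simp, by simp [pathWeight]⟩
  | @cons q r w e ih =>
    obtain ⟨s, d, h, hw⟩ := ih
    rcases e with ⟨⟨e⟩⟩ | ⟨⟨e⟩⟩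
    · exact ⟨s, d, by omega, by simp [pathWeight, arrowWeight, hw]⟩
    · exact ⟨s * (-1) ^ AVertex.val r, d + 1, by omega, by
        simp only [pathWeight, hw, arrowWeight, Sum.elim_inr, C_mul]; ring⟩

/-- The `k`-linear extension of the weight of paths to the path category. -/
noncomputable def weight {X Y : PathCategory k (Quiver.Symmetrify (AVertex n))} :
    (X ⟶ Y) →ₗ[k] k[X] :=
  Finsupp.linearCombination k (fun w : Quiver.Path (V := Quiver.Symmetrify (AVertex n)) X Y =>
    pathWeight k w)

variable {k}

theorem weight_single {X Y : PathCategory k (Quiver.Symmetrify (AVertex n))}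
    (w : Quiver.Path (V := Quiver.Symmetrify (AVertex n)) X Y) (r : k) :
    weight k (X := X) (Y := Y) (Finsupp.single w r) = r • pathWeight k w :=
  Finsupp.linearCombination_single k r w

@[elab_as_elim]
theorem pathCategory_induction {V : Type u} [Quiver.{v} V] {X Y : PathCategory k V}
    {P : (X ⟶ Y) → Prop} (f : X ⟶ Y) (zero : P 0) (add : ∀ f g, P f → P g → P (f + g))
    (single : ∀ (w : Quiver.Path (V := V) X Y) (r : k), P (Finsupp.single w r)) : P f :=
  Finsupp.induction_linear f zero add single

theorem weight_comp {X Y Z : PathCategory k (Quiver.Symmetrify (AVertex n))} (f : X ⟶ Y)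
    (g : Y ⟶ Z) : weight k (f ≫ g) = weight k f * weight k g := by
  induction f using pathCategory_induction with
  | zero => simp
  | add f₁ f₂ h₁ h₂ => simp [Preadditive.add_comp, h₁, h₂, add_mul]
  | single v r =>
    induction g using pathCategory_induction with
    | zero => simp
    | add f₁ f₂ h₁ h₂ => simp [Preadditive.comp_add, h₁, h₂, mul_add]
    | single w s =>
      have := Free.single_comp_single k (C := Paths (Quiver.Symmetrify (AVertex n))) v w r s
      erw [this]
      rw [weight_single, weight_single, weight_single]
      erw [pathWeight_comp]
      exact (smul_mul_smul_comm r _ s _).symm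

theorem weight_id (X : PathCategory k (Quiver.Symmetrify (AVertex n))) :
    weight k (𝟙 X) = 1 := by
  have := weight_single (k := k) (X := X) (Y := X) Quiver.Path.nil 1
  simpa [pathWeight] using! this

theorem weight_pathArrow {p q : Quiver.Symmetrify (AVertex n)} (e : p ⟶ q) :
    weight k (pathArrow k e) = arrowWeight k e := by
  have := weight_single (k := k) (X := pathObj k p) (Y := pathObj k q)
    (Quiver.Hom.toPath e) 1
  simpa [pathWeight, Quiver.Hom.toPath] using! this

/-- Getting from `p` down to `q` takes at least `p - q` downward arrows, and each contributes a
factor `X`. -/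
theorem coeff_weight_eq_zero {p q : AVertex n}
    (f : pathObj k (V := Quiver.Symmetrify (AVertex n)) p ⟶
      pathObj k (V := Quiver.Symmetrify (AVertex n)) q)
    {d : ℕ} (h : q.val + d < p.val) : (weight k f).coeff d = 0 := by
  induction f using pathCategory_induction with
  | zero => simp
  | add f₁ f₂ h₁ h₂ => simp [h₁, h₂]
  | single w r =>
    obtain ⟨s, e, he, hw⟩ := exists_pathWeight_eq k w
    rw [weight_single, hw, coeff_smul, coeff_C_mul, coeff_X_pow, if_neg, mul_zero, smul_zero]
    rintro rfl
    change p.val ≤ q.val + d at he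
    omega

end MeshDoubleA

/-! ### Neighbouring vertices and the arrows into a vertex. -/

namespace AVertex

variable {n : ℕ}

/-- An arrow of the double quiver with target `q` comes either from `q - 1` or from `q + 1`. -/
def costarEquiv (q : AVertex n) :
    Quiver.Costar (U := Quiver.Symmetrify (AVertex n)) q ≃ PLift (1 < q.val) ⊕ PLift (q.val < n) where
  toFun a := match a with
    | ⟨p, .inl e⟩ => .inl ⟨by have : p.val + 1 = q.val := e.down; have := p.one_le; omega⟩
    | ⟨p, .inr e⟩ => .inr ⟨by have : q.val + 1 = p.val := e.down; have := p.le; omega⟩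
  invFun := Sum.elim
    (fun h => ⟨(⟨q.val - 1, by have := h.down; omega, by have := q.le; omega⟩ : AVertex n),
      Sum.inl ⟨by have := h.down; simp only []; omega⟩⟩)
    (fun h => ⟨(⟨q.val + 1, by omega, h.down⟩ : AVertex n), Sum.inr ⟨rfl⟩⟩)
  left_inv := by
    rintro ⟨⟨p, hp, hp'⟩, ⟨⟨e⟩⟩ | ⟨⟨e⟩⟩⟩
    · obtain ⟨q, hq, hq'⟩ := q
      change p + 1 = q at e
      subst e
      rfl
    · change q.val + 1 = p at e
      subst e
      rfl
  right_inv := by rintro (h | h) <;> rfl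

/-- The vertex `q - 1`. -/
def pred (q : AVertex n) (h : 1 < q.val) : AVertex n :=
  ⟨q.val - 1, by omega, by have := q.le; omega⟩

/-- The vertex `q + 1`. -/
def succ (q : AVertex n) (h : q.val < n) : AVertex n := ⟨q.val + 1, by omega, h⟩

theorem pred_succ (q : AVertex n) (h : 1 < q.val) : (q.pred h).val + 1 = q.val := by
  change q.val - 1 + 1 = q.val
  omega

theorem eq_pred {p q : AVertex n} (h : p.val + 1 = q.val) : ∃ hq, p = q.pred hq :=
  ⟨by have := p.one_le; omega, AVertex.ext (by change _ = q.val - 1; omega)⟩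

theorem eq_succ {p q : AVertex n} (h : p.val + 1 = q.val) : ∃ hp, q = p.succ hp :=
  ⟨by have := q.le; omega, AVertex.ext h.symm⟩

theorem exists_val_eq {m : ℕ} (h : 1 ≤ m) (h' : m ≤ n) : ∃ r : AVertex n, r.val = m :=
  ⟨⟨m, h, h'⟩, rfl⟩

theorem succ_val (q : AVertex n) (h : q.val < n) : q.val + 1 = (q.succ h).val := rfl

end AVertex

/-! ### Coefficients of morphisms of the mesh category. -/

namespace MeshDoubleA

open Polynomial AVertex

variable (k : Type w) [CommRing k] {n : ℕ}

/-- The vertex `q`, as an object of the path category. -/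
noncomputable def pathVertex (q : AVertex n) : PathCategory k (Quiver.Symmetrify (AVertex n)) :=
  pathObj k (V := Quiver.Symmetrify (AVertex n)) q

/-- The arrow `a_p` in the path category. -/
noncomputable def pathA {p q : AVertex n} (h : p.val + 1 = q.val) :
    pathVertex k p ⟶ pathVertex k q :=
  pathArrow k (V := Quiver.Symmetrify (AVertex n)) (Sum.inl (PLift.up h))

/-- The arrow `(a_p)*` in the path category. -/
noncomputable def pathAStar {p q : AVertex n} (h : p.val + 1 = q.val) :
    pathVertex k q ⟶ pathVertex k p :=
  pathArrow k (V := Quiver.Symmetrify (AVertex n)) (Sum.inr (PLift.up h))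

/-- The mesh relation at `q`. -/
noncomputable def mesh (q : AVertex n) : pathVertex k q ⟶ pathVertex k q :=
  meshRelation k (V := Quiver.Symmetrify (AVertex n)) q

/-- Under `costarEquiv` the sum runs over two index types with at most one element each; an empty
one corresponds to an omitted summand. -/
theorem mesh_eq (q : AVertex n) :
    mesh k q =
      (if h : 1 < q.val then pathAStar k (q.pred_succ h) ≫ pathA k (q.pred_succ h) else 0) +
      (if h : q.val < n then pathA k (q.succ_val h) ≫ pathAStar k (q.succ_val h) else 0) := by
  classical
  unfold mesh meshRelation
  rw [← finsum_comp_equiv (costarEquiv q).symm, finsum_eq_sum_of_fintype, Fintype.sum_sum_type]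
  congr 1
  · by_cases h : 1 < q.val
    · rw [dif_pos h, Fintype.sum_subsingleton _ ⟨h⟩]; rfl
    · have : IsEmpty (PLift (1 < q.val)) := ⟨fun a => h a.down⟩
      rw [dif_neg h, Fintype.sum_empty]; rfl
  · by_cases h : q.val < n
    · rw [dif_pos h, Fintype.sum_subsingleton _ ⟨h⟩]; rfl
    · have : IsEmpty (PLift (q.val < n)) := ⟨fun a => h a.down⟩
      rw [dif_neg h, Fintype.sum_empty]; rfl

variable {k}

theorem weight_pathA {p q : AVertex n} (h : p.val + 1 = q.val) : weight k (pathA k h) = 1 :=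
  weight_pathArrow _

theorem weight_pathAStar {p q : AVertex n} (h : p.val + 1 = q.val) :
    weight k (pathAStar k h) = C ((-1) ^ p.val) * X :=
  weight_pathArrow _

theorem coeff_weight_of_lt {p q : AVertex n} (f : pathVertex k p ⟶ pathVertex k q)
    {d : ℕ} (h : q.val + d < p.val) : (weight k f).coeff d = 0 :=
  coeff_weight_eq_zero f h

/-- This determines the range in which coefficients descend to the mesh category: the weight of an
inner relation is zero, and that of a relation at an end vertex is pushed beyond degree `d` by the
paths around it. -/
theorem coeff_weight_mesh {p q r : AVertex n} (f : pathVertex k p ⟶ pathVertex k q)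
    (g : pathVertex k q ⟶ pathVertex k r) {d : ℕ} (h₁ : d < p.val) (h₂ : d < n + 1 - r.val) :
    (weight k (f ≫ mesh k q ≫ g)).coeff d = 0 := by
  -- The relation at an end vertex contributes one factor `X`. For `q = 1` the factor `f`
  -- contributes at least `p - 1` more, for `q = n` the factor `g` at least `n - r`.
  have hX (s : k) (h : q.val = 1 ∨ q.val = n) :
      (weight k f * (C s * X * weight k g)).coeff d = 0 := by
    rw [show weight k f * (C s * X * weight k g) = C s * (weight k f * weight k g * X) by ring,
      coeff_C_mul]
    cases d with
    | zero => simp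
    | succ d =>
      rw [coeff_mul_X, coeff_mul, Finset.sum_eq_zero, mul_zero]
      rintro ⟨i, j⟩ hij
      rw [Finset.HasAntidiagonal.mem_antidiagonal] at hij
      dsimp only at hij ⊢
      rcases h with h | h
      · rw [coeff_weight_of_lt f (by omega), zero_mul]
      · rw [coeff_weight_of_lt g (by omega), mul_zero]
  have h1 := q.one_le
  have hn := q.le
  rw [weight_comp, weight_comp, mesh_eq, map_add]
  by_cases hq : 1 < q.val <;> by_cases hq' : q.val < n
  -- Inner vertex: the weights `(-1)^(q-1) X` and `(-1)^q X` cancel.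
  · rw [dif_pos hq, dif_pos hq', weight_comp, weight_comp, weight_pathA, weight_pathA,
      weight_pathAStar, weight_pathAStar, ← pred_succ q hq, pow_succ]
    simp
  · rw [dif_pos hq, dif_neg hq', weight_comp, weight_pathA, weight_pathAStar, map_zero, add_zero,
      mul_one]
    exact hX _ (by omega)
  · rw [dif_neg hq, dif_pos hq', weight_comp, weight_pathA, weight_pathAStar, map_zero, zero_add,
      one_mul]
    exact hX _ (by omega)
  · rw [dif_neg hq, dif_neg hq']
    simp

theorem coeff_weight_meshIdeal {p q : AVertex n} {f : pathVertex k p ⟶ pathVertex k q}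
    (hf : f ∈ (meshIdeal k (Quiver.Symmetrify (AVertex n))).hom _ _) {d : ℕ}
    (h₁ : d < p.val) (h₂ : d < n + 1 - q.val) : (weight k f).coeff d = 0 := by
  refine (Submodule.span_le (p := LinearMap.ker ((lcoeff k d).comp (weight k)))).2 ?_ hf
  rintro _ ⟨x, y, f, s, g, ⟨q⟩, rfl⟩
  exact coeff_weight_mesh f g h₁ h₂

/-- The projection from the path category to the mesh category. -/
noncomputable def proj {p q : AVertex n} :
    (pathVertex k p ⟶ pathVertex k q) →ₗ[k] (obj k p ⟶ obj k q) where
  toFun f := (CategoryTheory.Quotient.functor (meshIdeal k (Quiver.Symmetrify (AVertex n))).rel).map f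
  map_add' _ _ := rfl
  map_smul' _ _ := rfl

theorem proj_surjective {p q : AVertex n} (f : obj k p ⟶ obj k q) : ∃ f', proj f' = f :=
  (CategoryTheory.Quotient.functor
    (meshIdeal k (Quiver.Symmetrify (AVertex n))).rel).map_surjective f

theorem proj_comp {p q r : AVertex n} (f : pathVertex k p ⟶ pathVertex k q)
    (g : pathVertex k q ⟶ pathVertex k r) : proj (f ≫ g) = proj f ≫ proj g := rfl

theorem proj_id (p : AVertex n) : proj (𝟙 (pathVertex k p)) = 𝟙 (obj k p) := rfl

theorem proj_pathA {p q : AVertex n} (h : p.val + 1 = q.val) : proj (pathA k h) = a k h := rfl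

theorem proj_pathAStar {p q : AVertex n} (h : p.val + 1 = q.val) :
    proj (pathAStar k h) = aStar k h := rfl

theorem proj_eq_proj_iff {p q : AVertex n} {f g : pathVertex k p ⟶ pathVertex k q} :
    proj f = proj g ↔ f - g ∈ (meshIdeal k (Quiver.Symmetrify (AVertex n))).hom _ _ :=
  CategoryTheory.Quotient.functor_map_eq_iff _ f g

theorem proj_eq_zero_iff {p q : AVertex n} {f : pathVertex k p ⟶ pathVertex k q} :
    proj f = 0 ↔ f ∈ (meshIdeal k (Quiver.Symmetrify (AVertex n))).hom _ _ := by
  rw [← map_zero proj, proj_eq_proj_iff, sub_zero]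

theorem proj_mesh (q : AVertex n) : proj (mesh k q) = 0 :=
  proj_eq_zero_iff.2 (Submodule.subset_span ⟨_, _, 𝟙 _, mesh k q, 𝟙 _,
    ⟨q⟩, by simp⟩)

/-- The coefficient of `X ^ d` of the weight of a morphism of the mesh category, which is well
defined for `d < min {p, n + 1 - q}`. -/
noncomputable def coeff {p q : AVertex n} (d : ℕ) : (obj k p ⟶ obj k q) →ₗ[k] k :=
  open Classical in
  if h : d < p.val ∧ d < n + 1 - q.val then
    (proj.ker.liftQ ((lcoeff k d).comp (weight k)) (fun _ hf =>
      coeff_weight_meshIdeal (proj_eq_zero_iff.1 hf) h.1 h.2)).comp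
        (proj.quotKerEquivOfSurjective proj_surjective).symm.toLinearMap
  -- Outside the range the value 0 is the true one for the normal form expansion, since the
  -- corresponding normal forms vanish.
  else 0

theorem coeff_proj {p q : AVertex n} {d : ℕ} (h₁ : d < p.val) (h₂ : d < n + 1 - q.val)
    (f : pathVertex k p ⟶ pathVertex k q) :
    coeff d (proj f) = (weight k f).coeff d := by
  rw [coeff, dif_pos ⟨h₁, h₂⟩, LinearMap.comp_apply, LinearEquiv.coe_coe,
    show (proj.quotKerEquivOfSurjective proj_surjective).symm (proj f) = Submodule.Quotient.mk f by
      rw [LinearEquiv.symm_apply_eq]; rfl]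
  rfl

theorem coeff_of_le {p q : AVertex n} {d : ℕ} (h : p.val ≤ d ∨ n + 1 - q.val ≤ d)
    (f : obj k p ⟶ obj k q) : coeff d f = 0 := by
  rw [coeff, dif_neg (by omega), LinearMap.zero_apply]

theorem coeff_of_lt {p q : AVertex n} {d : ℕ} (h : q.val + d < p.val)
    (f : obj k p ⟶ obj k q) : coeff d f = 0 := by
  by_cases h' : d < n + 1 - q.val
  · obtain ⟨f, rfl⟩ := proj_surjective f
    exact (coeff_proj (by omega) h' f).trans (coeff_weight_of_lt f h)
  · exact coeff_of_le (by omega) f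

/-- Weights multiply in the path category. The point is that a factor's coefficient may lie outside
its own range, where `coeff` is 0 by convention; the other factor of that term is then zero because
it has too few downward arrows. -/
theorem coeff_comp {p q r : AVertex n} {d : ℕ} (h₁ : d < p.val) (h₂ : d < n + 1 - r.val)
    (f : obj k p ⟶ obj k q) (g : obj k q ⟶ obj k r) :
    coeff d (f ≫ g) =
      ∑ x ∈ Finset.HasAntidiagonal.antidiagonal d, coeff x.1 f * coeff x.2 g := by
  obtain ⟨f, rfl⟩ := proj_surjective f
  obtain ⟨g, rfl⟩ := proj_surjective g
  rw [← proj_comp, coeff_proj h₁ h₂, weight_comp, coeff_mul]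
  refine Finset.sum_congr rfl ?_
  rintro ⟨i, j⟩ hij
  rw [Finset.HasAntidiagonal.mem_antidiagonal] at hij
  dsimp only at hij ⊢
  by_cases hf : q.val + i < p.val
  · rw [coeff_weight_of_lt f hf, coeff_of_lt hf, zero_mul, zero_mul]
  by_cases hg : r.val + j < q.val
  · rw [coeff_weight_of_lt g hg, coeff_of_lt hg, mul_zero, mul_zero]
  have := r.le
  have := q.le
  -- Now `p ≤ q + i` and `q ≤ r + j`, so the bounds on `i + j` force `i` and `j` into range.
  rw [coeff_proj (by omega) (by omega), coeff_proj (by omega) (by omega)]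

end MeshDoubleA

/-! ### Commutation relations and normal forms. -/

namespace MeshDoubleA

open Polynomial AVertex

variable {k : Type w} [CommRing k] {n : ℕ}

/-- A property of morphisms with a fixed source holds for all of them if it holds for the identity,
is closed under linear combinations, and under composition with arrows. -/
theorem hom_induction {p : AVertex n} {P : ∀ {q : AVertex n}, (obj k p ⟶ obj k q) → Prop}
    (zero : ∀ q : AVertex n, P (0 : obj k p ⟶ obj k q))
    (add : ∀ {q : AVertex n} (f g : obj k p ⟶ obj k q), P f → P g → P (f + g))
    (smul : ∀ {q : AVertex n} (x : k) (f : obj k p ⟶ obj k q), P f → P (x • f))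
    (id : P (𝟙 (obj k p)))
    (comp_a : ∀ {q r : AVertex n} (h : q.val + 1 = r.val) (f : obj k p ⟶ obj k q),
      P f → P (f ≫ a k h))
    (comp_aStar : ∀ {q r : AVertex n} (h : r.val + 1 = q.val) (f : obj k p ⟶ obj k q),
      P f → P (f ≫ aStar k h))
    {q : AVertex n} (f : obj k p ⟶ obj k q) : P f := by
  have key : ∀ {q : Quiver.Symmetrify (AVertex n)}
      (w : Quiver.Path (V := Quiver.Symmetrify (AVertex n)) p q),
      P (q := q) (proj (q := q) (Finsupp.single w 1)) := by
    intro q w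
    induction w with
    | nil => exact id
    | @cons q r w e ih =>
      have h : (Finsupp.single (w.cons e) 1 : pathVertex k p ⟶ pathVertex k r) =
          (Finsupp.single w 1 : pathVertex k p ⟶ pathVertex k q) ≫ pathArrow k e :=
        ((Free.single_comp_single k (C := Paths (Quiver.Symmetrify (AVertex n))) w e.toPath
          1 1).trans (by rw [mul_one]; rfl)).symm
      refine (congrArg (fun f => P (q := r) (proj f)) h).mpr ?_
      rcases e with ⟨⟨e⟩⟩ | ⟨⟨e⟩⟩
      · exact comp_a e _ ih
      · exact comp_aStar e _ ih
  obtain ⟨f, rfl⟩ := proj_surjective f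
  induction f using pathCategory_induction with
  | zero => rw [map_zero]; exact zero q
  | add f g hf hg => rw [map_add]; exact add _ _ hf hg
  | single w r =>
    have h : proj (p := p) (q := q) (Finsupp.single w r) =
        r • proj (p := p) (q := q) (Finsupp.single w 1) := by
      rw [← map_smul]
      congr 1
      exact (Finsupp.smul_single_one w r).symm
    rw [h]
    exact smul _ _ (key w)

variable (k) in
/-- The arrow `(a_p)*` with a sign such that the mesh relations become commutativity relations. -/
noncomputable def b {p q : AVertex n} (h : p.val + 1 = q.val) : obj k q ⟶ obj k p :=
  (-1 : k) ^ p.val • aStar k h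

theorem aStar_eq {p q : AVertex n} (h : p.val + 1 = q.val) :
    aStar k h = (-1 : k) ^ p.val • b k h := by
  rw [b, smul_smul, ← mul_pow, neg_one_mul, neg_neg, one_pow, one_smul]

theorem mesh_relation (q : AVertex n) :
    (if h : 1 < q.val then aStar k (q.pred_succ h) ≫ a k (q.pred_succ h) else 0) +
      (if h : q.val < n then a k (q.succ_val h) ≫ aStar k (q.succ_val h) else 0) = 0 := by
  refine Eq.trans ?_ (proj_mesh q)
  rw [mesh_eq, map_add]
  congr 1
  · split_ifs
    · rfl
    · rw [map_zero]
  · split_ifs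
    · rfl
    · rw [map_zero]

/-- The signs of consecutive `b`'s differ by -1, which turns the sum in the mesh relation into a
difference. -/
theorem b_comp_a {p q r : AVertex n} (h : p.val + 1 = q.val) (h' : q.val + 1 = r.val) :
    b k h ≫ a k h = a k h' ≫ b k h' := by
  have hq := p.one_le
  have hr := r.le
  obtain ⟨hq', rfl⟩ := eq_pred h
  obtain ⟨hr', rfl⟩ := eq_succ h'
  have := mesh_relation (k := k) q
  rw [dif_pos (by omega), dif_pos (by omega)] at this
  rw [b, b, Linear.smul_comp, Linear.comp_smul, ← h, pow_succ, mul_neg_one, neg_smul,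
    eq_neg_iff_add_eq_zero, ← smul_add, this, smul_zero]

theorem a_comp_b_eq_zero {p q : AVertex n} (h : p.val + 1 = q.val) (hp : p.val = 1) :
    a k h ≫ b k h = 0 := by
  have hq := q.le
  obtain ⟨hp', rfl⟩ := eq_succ h
  have := mesh_relation (k := k) p
  rw [dif_neg (by omega), dif_pos (by omega), zero_add] at this
  rw [b, Linear.comp_smul, this, smul_zero]

theorem b_comp_a_eq_zero {p q : AVertex n} (h : p.val + 1 = q.val) (hq : q.val = n) :
    b k h ≫ a k h = 0 := by
  have hp := p.one_le
  obtain ⟨hq', rfl⟩ := eq_pred h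
  have := mesh_relation (k := k) q
  rw [dif_pos (by omega), dif_neg (by omega), add_zero] at this
  rw [b, Linear.smul_comp, this, smul_zero]

variable (k) in
/-- The composite of `u` consecutive arrows `a_p`. -/
noncomputable def up : ∀ (u : ℕ) {p q : AVertex n}, p.val + u = q.val → (obj k p ⟶ obj k q)
  | 0, _, _, h => eqToHom (congrArg (obj k) (AVertex.ext h))
  | u + 1, p, q, h =>
    have hq : 1 < q.val := by have := p.one_le; omega
    up u (q := q.pred hq) (by change _ = q.val - 1; omega) ≫ a k (q.pred_succ hq)

variable (k) in
/-- The composite of `d` consecutive arrows `b_p`. -/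
noncomputable def down : ∀ (d : ℕ) {p q : AVertex n}, q.val + d = p.val → (obj k p ⟶ obj k q)
  | 0, _, _, h => eqToHom (congrArg (obj k) (AVertex.ext h.symm))
  | d + 1, p, q, h =>
    have hq : q.val < n := by have := p.le; omega
    down d (q := q.succ hq) (by change q.val + 1 + d = _; omega) ≫ b k (q.succ_val hq)

theorem up_zero (p : AVertex n) : up k 0 (rfl : p.val + 0 = p.val) = 𝟙 _ := rfl

theorem down_zero (p : AVertex n) : down k 0 (rfl : p.val + 0 = p.val) = 𝟙 _ := rfl

/-- Frees the recursion from `pred`: the intermediate vertex may be any term with the right value.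
-/
theorem up_succ {u : ℕ} {p q r : AVertex n} (h : p.val + (u + 1) = r.val) (h₁ : p.val + u = q.val)
    (h₂ : q.val + 1 = r.val) : up k (u + 1) h = up k u h₁ ≫ a k h₂ := by
  have := p.one_le
  obtain ⟨hr, rfl⟩ := eq_pred h₂
  rfl

theorem down_succ {d : ℕ} {p q r : AVertex n} (h : r.val + (d + 1) = p.val)
    (h₁ : q.val + d = p.val) (h₂ : r.val + 1 = q.val) :
    down k (d + 1) h = down k d h₁ ≫ b k h₂ := by
  have := p.le
  obtain ⟨hr, rfl⟩ := eq_succ h₂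
  rfl

/-- The arrow `b` slides back along the ascending path through a ladder of commuting squares. -/
theorem up_comp_b {u : ℕ} : ∀ {p p' q q' : AVertex n} (h : p.val + u = q.val)
    (hp : p'.val + 1 = p.val) (hq : q'.val + 1 = q.val) (h' : p'.val + u = q'.val),
    up k u h ≫ b k hq = b k hp ≫ up k u h' := by
  induction u with
  | zero =>
    intro p p' q q' h hp hq h'
    obtain rfl : p = q := AVertex.ext h
    obtain rfl : p' = q' := AVertex.ext h'
    rw [up_zero, up_zero, Category.id_comp, Category.comp_id]
  | succ u ih =>
    intro p p' q q' h hp hq h'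
    have := p'.one_le
    have h₁ := q'.pred_succ (by omega)
    rw [up_succ h (q := q') (by omega) hq,
      up_succ h' (q := q'.pred (by omega)) (by omega) h₁, Category.assoc, ← b_comp_a h₁ hq,
      ← Category.assoc, ih (q' := q'.pred (by omega)) _ hp h₁ (by omega), Category.assoc]

/-- Sliding `b` back to the start produces the composite `ab` at vertex 1, which is the mesh
relation there. -/
theorem up_comp_b_eq_zero {u : ℕ} : ∀ {p q q' : AVertex n} (h : p.val + (u + 1) = q.val)
    (_ : p.val = 1) (hq : q'.val + 1 = q.val), up k (u + 1) h ≫ b k hq = 0 := by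
  induction u with
  | zero =>
    intro p q q' h hp hq
    obtain rfl : p = q' := AVertex.ext (by omega)
    rw [up_succ h rfl hq, Category.assoc, a_comp_b_eq_zero _ hp, Limits.comp_zero]
  | succ u ih =>
    intro p q q' h hp hq
    have h₁ := q'.pred_succ (by omega)
    rw [up_succ h (q := q') (by omega) hq, Category.assoc, ← b_comp_a h₁ hq,
      ← Category.assoc, ih _ hp h₁, Limits.zero_comp]

variable (k) in
/-- The normal form of a path from `p` to `q` with `d` downward arrows, with a sign such that its
weight is `X ^ d`; it goes down first. -/
noncomputable def normalPath (p q : AVertex n) (d : ℕ) : obj k p ⟶ obj k q :=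
  if h : d < p.val ∧ p.val ≤ q.val + d then
    down k d (q := ⟨p.val - d, by omega, by have := p.le; omega⟩) (by simp only []; omega) ≫
      up k (q.val + d - p.val) (by simp only []; omega)
  else 0

theorem normalPath_eq {p q r : AVertex n} {d u : ℕ} (h₁ : r.val + d = p.val)
    (h₂ : r.val + u = q.val) : normalPath k p q d = down k d h₁ ≫ up k u h₂ := by
  have := r.one_le
  obtain rfl : u = q.val + d - p.val := by omega
  have hp : d < p.val ∧ p.val ≤ q.val + d := by omega
  obtain ⟨_, _, rfl⟩ : ∃ h h', r = ⟨p.val - d, h, h'⟩ :=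
    ⟨by omega, by have := p.le; omega, AVertex.ext (by change r.val = p.val - d; omega)⟩
  rw [normalPath, dif_pos hp]

theorem normalPath_of_le {p q : AVertex n} {d : ℕ} (h : p.val ≤ d) : normalPath k p q d = 0 := by
  rw [normalPath, dif_neg (by omega)]

theorem normalPath_of_lt {p q : AVertex n} {d : ℕ} (h : q.val + d < p.val) :
    normalPath k p q d = 0 := by
  rw [normalPath, dif_neg (by omega)]

theorem normalPath_self_zero (p : AVertex n) : normalPath k p p 0 = 𝟙 _ := by
  rw [normalPath_eq (r := p) (d := 0) (u := 0) rfl rfl, down_zero, up_zero, Category.id_comp]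

/-- The condition `hd` matters: for `q + d + 1 = p` with `d < p`, the left side is 0 by definition,
while the right side is a descending path. -/
theorem normalPath_comp_a {p q r : AVertex n} {d : ℕ} (hd : p.val ≤ q.val + d)
    (h : q.val + 1 = r.val) : normalPath k p q d ≫ a k h = normalPath k p r d := by
  rcases le_or_gt p.val d with hp | hp
  · rw [normalPath_of_le hp, normalPath_of_le hp, Limits.zero_comp]
  have := p.le
  obtain ⟨s, hs⟩ := exists_val_eq (n := n) (m := p.val - d) (by omega) (by omega)
  rw [normalPath_eq (r := s) (u := q.val + d - p.val) (by omega) (by omega),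
    normalPath_eq (r := s) (u := q.val + d - p.val + 1) (by omega) (by omega), Category.assoc,
    ← up_succ]

theorem normalPath_comp_b {p q r : AVertex n} {d : ℕ} (hd : p.val ≤ q.val + d)
    (h : r.val + 1 = q.val) : normalPath k p q d ≫ b k h = normalPath k p r (d + 1) := by
  rcases le_or_gt p.val d with hp | hp
  · rw [normalPath_of_le hp, normalPath_of_le (by omega), Limits.zero_comp]
  have := p.le
  have := r.one_le
  obtain ⟨s, hs⟩ := exists_val_eq (n := n) (m := p.val - d) (by omega) (by omega)
  -- If `p = d + 1`, the descent has already reached vertex 1 and the extra `b` kills the path;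
  -- otherwise `b` slides back to extend the descent.
  rcases le_or_gt p.val (d + 1) with hp' | hp'
  · rw [normalPath_of_le hp', normalPath_eq (r := s) (u := r.val - 1 + 1) (by omega) (by omega),
      Category.assoc, up_comp_b_eq_zero _ (by omega), Limits.comp_zero]
  · obtain ⟨t, ht⟩ := exists_val_eq (n := n) (m := p.val - d - 1) (by omega) (by omega)
    rw [normalPath_eq (r := s) (u := q.val + d - p.val) (by omega) (by omega),
      normalPath_eq (r := t) (u := q.val + d - p.val) (by omega) (by omega), Category.assoc,
      up_comp_b (p' := t) _ (by omega) _ (by omega), down_succ (q := s) _ (by omega) (by omega),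
      Category.assoc]

/-- Although normal forms descend first, they can be rewritten to end in `b`, so the target moves up
step by step to `n`. There the path can be made to end in `ba`, which is zero. -/
theorem normalPath_of_le_target {p : AVertex n} {d : ℕ} : ∀ {q : AVertex n}, n + 1 - q.val ≤ d →
    normalPath k p q d = 0 := by
  induction d with
  | zero => intro q h; have := q.le; omega
  | succ d ih =>
    intro q h
    have := q.le
    have := p.le
    rcases lt_or_ge (q.val + (d + 1)) p.val with hd | hd
    · exact normalPath_of_lt hd
    rcases le_or_gt p.val (d + 1) with hp | hp
    · exact normalPath_of_le hp
    rcases q.le.lt_or_eq with hq | hq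
    · rw [← normalPath_comp_b (q := q.succ (by omega)) (by change _ ≤ q.val + 1 + d; omega)
        (q.succ_val _), ih (by change n + 1 - (q.val + 1) ≤ d; omega), Limits.zero_comp]
    · have h₁ := q.pred_succ (by omega)
      rw [← normalPath_comp_a (by omega) h₁, ← normalPath_comp_b (by omega) h₁, Category.assoc,
        b_comp_a_eq_zero h₁ hq, Limits.comp_zero]

end MeshDoubleA

/-! ### Normal forms as a basis. -/

namespace MeshDoubleA

open Polynomial AVertex

variable {k : Type w} [CommRing k] {n : ℕ}

/-- `f` has a representative in the path category whose weight is `P`. -/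
def HasWeight {p q : AVertex n} (f : obj k p ⟶ obj k q) (P : k[X]) : Prop :=
  ∃ f' : pathVertex k p ⟶ pathVertex k q, proj f' = f ∧ weight k f' = P

theorem HasWeight.comp {p q r : AVertex n} {f : obj k p ⟶ obj k q} {g : obj k q ⟶ obj k r}
    {P Q : k[X]} (hf : HasWeight f P) (hg : HasWeight g Q) : HasWeight (f ≫ g) (P * Q) := by
  obtain ⟨f, rfl, rfl⟩ := hf
  obtain ⟨g, rfl, rfl⟩ := hg
  exact ⟨f ≫ g, proj_comp f g, weight_comp f g⟩

theorem hasWeight_id (p : AVertex n) : HasWeight (𝟙 (obj k p)) 1 :=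
  ⟨𝟙 _, proj_id p, weight_id _⟩

theorem hasWeight_a {p q : AVertex n} (h : p.val + 1 = q.val) : HasWeight (a k h) 1 :=
  ⟨pathA k h, proj_pathA h, weight_pathA h⟩

theorem hasWeight_b {p q : AVertex n} (h : p.val + 1 = q.val) : HasWeight (b k h) X := by
  refine ⟨(-1 : k) ^ p.val • pathAStar k h, by rw [map_smul, proj_pathAStar, b], ?_⟩
  rw [map_smul, weight_pathAStar, smul_eq_C_mul, ← mul_assoc, ← C_mul, ← mul_pow, neg_one_mul,
    neg_neg, one_pow, C_1, one_mul]

theorem hasWeight_up {u : ℕ} : ∀ {p q : AVertex n} (h : p.val + u = q.val),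
    HasWeight (up k u h) 1 := by
  induction u with
  | zero =>
    intro p q h
    obtain rfl : p = q := AVertex.ext h
    exact hasWeight_id p
  | succ u ih =>
    intro p q h
    have := p.one_le
    have h₁ := q.pred_succ (by omega)
    rw [up_succ h (by omega) h₁]
    simpa using (ih _).comp (hasWeight_a h₁)

theorem hasWeight_down {d : ℕ} : ∀ {p q : AVertex n} (h : q.val + d = p.val),
    HasWeight (down k d h) (X ^ d) := by
  induction d with
  | zero =>
    intro p q h
    obtain rfl : q = p := AVertex.ext h
    rw [pow_zero]
    exact hasWeight_id q
  | succ d ih =>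
    intro p q h
    have := p.le
    have h₁ := q.succ_val (by omega)
    rw [down_succ h (by omega) h₁, pow_succ]
    exact (ih _).comp (hasWeight_b h₁)

theorem HasWeight.coeff_eq {p q : AVertex n} {f : obj k p ⟶ obj k q} {P : k[X]}
    (hf : HasWeight f P) {d : ℕ} (h₁ : d < p.val) (h₂ : d < n + 1 - q.val) :
    coeff d f = P.coeff d := by
  obtain ⟨f, rfl, rfl⟩ := hf
  exact coeff_proj h₁ h₂ f

theorem coeff_normalPath {p q : AVertex n} {d e : ℕ} (hd : p.val ≤ q.val + d) (he : e < p.val)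
    (he' : e < n + 1 - q.val) : coeff e (normalPath k p q d) = if e = d then 1 else 0 := by
  rcases le_or_gt p.val d with hp | hp
  · rw [normalPath_of_le hp, map_zero, if_neg (by omega)]
  have := p.le
  obtain ⟨s, hs⟩ := exists_val_eq (n := n) (m := p.val - d) (by omega) (by omega)
  rw [normalPath_eq (r := s) (u := q.val + d - p.val) (by omega) (by omega),
    ((hasWeight_down _).comp (hasWeight_up _)).coeff_eq he he', mul_one, coeff_X_pow]

theorem coeff_normalPath_self {p q : AVertex n} {d : ℕ} (hd : p.val ≤ q.val + d) (hp : d < p.val)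
    (hq : d < n + 1 - q.val) : coeff d (normalPath k p q d) = 1 := by
  rw [coeff_normalPath hd hp hq, if_pos rfl]

theorem coeff_normalPath_of_ne {p q : AVertex n} {d e : ℕ} (h : e ≠ d) :
    coeff e (normalPath k p q d) = 0 := by
  by_cases hd : p.val ≤ q.val + d
  · by_cases he : e < p.val ∧ e < n + 1 - q.val
    · rw [coeff_normalPath hd he.1 he.2, if_neg h]
    · exact coeff_of_le (by omega) _
  · rw [normalPath_of_lt (by omega), map_zero]

/-- Every morphism is the linear combination of normal forms given by its coefficients. -/
theorem sum_coeff_smul_normalPath {p q : AVertex n} (f : obj k p ⟶ obj k q) :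
    ∑ d ∈ Finset.range n, coeff d f • normalPath k p q d = f := by
  have span : f ∈ Submodule.span k {g | ∃ d, p.val ≤ q.val + d ∧ g = normalPath k p q d} := by
    induction f using hom_induction with
    | zero => exact Submodule.zero_mem _
    | add f g hf hg => exact Submodule.add_mem _ hf hg
    | smul x f hf => exact Submodule.smul_mem _ x hf
    | id => exact Submodule.subset_span ⟨0, le_rfl, (normalPath_self_zero p).symm⟩
    | comp_a h f hf =>
      refine (Submodule.span_le (p := (Submodule.span k _).comap
        (Linear.rightComp k (obj k p) (a k h)))).2 ?_ hf
      rintro _ ⟨d, hd, rfl⟩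
      exact Submodule.subset_span ⟨d, by omega, normalPath_comp_a hd h⟩
    | comp_aStar h f hf =>
      rw [aStar_eq, Linear.comp_smul]
      refine Submodule.smul_mem _ _ ?_
      refine (Submodule.span_le (p := (Submodule.span k _).comap
        (Linear.rightComp k (obj k p) (b k h)))).2 ?_ hf
      rintro _ ⟨d, hd, rfl⟩
      exact Submodule.subset_span ⟨d + 1, by omega, normalPath_comp_b hd h⟩
  -- The expansion formula is linear in `f`, so it is enough to check it on normal forms.
  induction span using Submodule.span_induction with
  | mem f hf =>
    obtain ⟨d, hd, rfl⟩ := hf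
    by_cases h : d < p.val ∧ d < n + 1 - q.val
    · have := p.le
      rw [Finset.sum_eq_single d, coeff_normalPath_self hd h.1 h.2, one_smul]
      · exact fun e _ he => by rw [coeff_normalPath_of_ne he, zero_smul]
      · exact fun hd' => absurd (Finset.mem_range.2 (by omega)) hd'
    · have h0 : normalPath k p q d = 0 := by
        rcases le_or_gt p.val d with h' | h'
        · exact normalPath_of_le h'
        · exact normalPath_of_le_target (by omega)
      simp [h0]
  | zero => simp
  | add f g _ _ hf hg => simp only [map_add, add_smul, Finset.sum_add_distrib, hf, hg]
  | smul x f _ hf => simp only [map_smul, smul_assoc, ← Finset.smul_sum, hf]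

/-- All coefficients outside the listed range vanish for both morphisms. -/
theorem ext_coeff {p q : AVertex n} {f g : obj k p ⟶ obj k q}
    (h : ∀ d, p.val ≤ q.val + d → d < p.val → d < n + 1 - q.val → coeff d f = coeff d g) :
    f = g := by
  rw [← sum_coeff_smul_normalPath f, ← sum_coeff_smul_normalPath g]
  refine Finset.sum_congr rfl fun d _ => ?_
  congr 1
  by_cases h₁ : p.val ≤ q.val + d
  · by_cases h₂ : d < p.val ∧ d < n + 1 - q.val
    · exact h d h₁ h₂.1 h₂.2
    · rw [coeff_of_le (by omega), coeff_of_le (by omega)]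
  · rw [coeff_of_lt (by omega), coeff_of_lt (by omega)]

/-- Composing with a normal form is multiplication by `X^e`, hence a shift of coefficients. -/
theorem coeff_comp_normalPath {p q r : AVertex n} {d e : ℕ} (hd : d + e < p.val)
    (hd' : d + e < n + 1 - r.val) (he : q.val ≤ r.val + e) (f : obj k p ⟶ obj k q) :
    coeff (d + e) (f ≫ normalPath k q r e) = coeff d f := by
  rw [coeff_comp hd hd', Finset.sum_eq_single (d, e)]
  · dsimp only
    by_cases hq : e < q.val
    · rw [coeff_normalPath_self he hq (by omega), mul_one]
    -- For `e ≥ q` the normal form is zero, but then `d < p - q`, so the coefficient of `f` is zero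
    -- too.
    · rw [coeff_of_lt (by omega) f, zero_mul]
  · rintro ⟨i, j⟩ hij hne
    rw [Finset.HasAntidiagonal.mem_antidiagonal] at hij
    dsimp only at hij ⊢
    rw [coeff_normalPath_of_ne, mul_zero]
    rintro rfl
    exact hne (by rw [Nat.add_right_cancel hij])
  · exact fun h => (h (Finset.HasAntidiagonal.mem_antidiagonal.2 rfl)).elim

theorem coeff_normalPath_comp {p q r : AVertex n} {d e : ℕ} (hd : e + d < p.val)
    (hd' : e + d < n + 1 - r.val) (he : p.val ≤ q.val + e) (f : obj k q ⟶ obj k r) :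
    coeff (e + d) (normalPath k p q e ≫ f) = coeff d f := by
  rw [coeff_comp hd hd', Finset.sum_eq_single (e, d)]
  · dsimp only
    by_cases hq : e < n + 1 - q.val
    · rw [coeff_normalPath_self he (by omega) hq, one_mul]
    · have := q.le
      rw [coeff_of_lt (by omega) f, mul_zero]
  · rintro ⟨i, j⟩ hij hne
    rw [Finset.HasAntidiagonal.mem_antidiagonal] at hij
    dsimp only at hij ⊢
    rw [coeff_normalPath_of_ne, zero_mul]
    rintro rfl
    exact hne (by rw [Nat.add_left_cancel hij])
  · exact fun h => (h (Finset.HasAntidiagonal.mem_antidiagonal.2 rfl)).elim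

variable (k) in
/-- The normal forms are a basis. -/
noncomputable def basis (p q : AVertex n) :
    Module.Basis (Fin (min (min p.val q.val) (min (n + 1 - p.val) (n + 1 - q.val)))) k
      (obj k p ⟶ obj k q) :=
  .ofEquivFun
    -- Truncated subtraction makes `p - q` the least possible degree `max(p - q, 0)`. The number of
    -- degrees from there to `min(p, n + 1 - q)` is the stated minimum of four terms.
    { toFun f i := coeff (p.val - q.val + i) f
      map_add' f g := by ext i; simp
      map_smul' x f := by ext i; simp
      invFun c := ∑ i, c i • normalPath k p q (p.val - q.val + i)
      left_inv f := by
        refine ext_coeff fun d h₁ h₂ h₃ => ?_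
        have := p.one_le
        have := q.le
        rw [map_sum, Finset.sum_eq_single ⟨d - (p.val - q.val), by omega⟩]
        · dsimp only
          rw [show p.val - q.val + (d - (p.val - q.val)) = d by omega, map_smul,
            coeff_normalPath_self h₁ h₂ h₃, smul_eq_mul, mul_one]
        · intro i _ hi
          rw [map_smul, coeff_normalPath_of_ne, smul_zero]
          rintro rfl
          exact hi (Fin.ext (by simp))
        · simp
      right_inv c := by
        ext i
        have := i.2
        have := p.le
        have := q.le
        dsimp only
        rw [map_sum, Finset.sum_eq_single i]
        · rw [map_smul, coeff_normalPath_self (by omega) (by omega) (by omega), smul_eq_mul,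
            mul_one]
        · intro j _ hj
          rw [map_smul, coeff_normalPath_of_ne, smul_zero]
          intro h
          exact hj (Fin.ext (by omega))
        · simp }

end MeshDoubleA

/-! ### The arrow ideal: length filtration, complements, nilpotency. -/

namespace MeshDoubleA

open Polynomial AVertex

variable {k : Type w} [CommRing k] {n : ℕ}

/-- `f` is a linear combination of paths of length at least `m`; the normal form of weight `X ^ d`
has length `2 * d + q - p`. -/
def LengthGE (m : ℕ) {p q : AVertex n} (f : obj k p ⟶ obj k q) : Prop :=
  ∀ d, 2 * d + q.val < m + p.val → coeff d f = 0

theorem lengthGE_zero {p q : AVertex n} (f : obj k p ⟶ obj k q) : LengthGE 0 f :=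
  fun _ _ => coeff_of_lt (by omega) f

theorem lengthGE_a {p q : AVertex n} (h : p.val + 1 = q.val) : LengthGE 1 (a k h) :=
  fun _ _ => absurd h (by omega)

theorem lengthGE_aStar {p q : AVertex n} (h : p.val + 1 = q.val) : LengthGE 1 (aStar k h) := by
  intro d hd
  have := p.le
  obtain rfl : d = 0 := by omega
  rw [aStar_eq, map_smul, (hasWeight_b h).coeff_eq (by omega) (by omega), coeff_X_zero, smul_zero]

/-- Length is additive, so in each term of the convolution at least one factor is below its bound.
-/
theorem LengthGE.comp {m l : ℕ} {p q r : AVertex n} {f : obj k p ⟶ obj k q}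
    {g : obj k q ⟶ obj k r} (hf : LengthGE m f) (hg : LengthGE l g) :
    LengthGE (m + l) (f ≫ g) := by
  intro d hd
  by_cases h : d < p.val ∧ d < n + 1 - r.val
  · rw [coeff_comp h.1 h.2, Finset.sum_eq_zero]
    rintro ⟨i, j⟩ hij
    rw [Finset.HasAntidiagonal.mem_antidiagonal] at hij
    dsimp only at hij ⊢
    by_cases hi : 2 * i + q.val < m + p.val
    · rw [hf i hi, zero_mul]
    · rw [hg j (by omega), mul_zero]
  · exact coeff_of_le (by omega) _

variable (k n) in
/-- The morphisms satisfying `LengthGE m` form a submodule. -/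
noncomputable def lengthSubmodule (m : ℕ) (p q : AVertex n) : Submodule k (obj k p ⟶ obj k q) where
  carrier := {f | LengthGE m f}
  zero_mem' _ _ := map_zero _
  add_mem' hf hg d hd := by rw [map_add, hf d hd, hg d hd, add_zero]
  smul_mem' x f hf d hd := by rw [map_smul, hf d hd, smul_zero]

theorem lengthGE_of_mem_arrowIdeal {p q : AVertex n} {f : obj k p ⟶ obj k q}
    (hf : f ∈ (arrowIdeal k (Quiver.Symmetrify (AVertex n))).hom (obj k p) (obj k q)) :
    LengthGE 1 f := by
  refine (Submodule.span_le (p := lengthSubmodule k n 1 p q)).2 ?_ hf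
  rintro _ ⟨x, y, f, s, g, ⟨⟨x, y, ⟨⟨e⟩⟩ | ⟨⟨e⟩⟩⟩⟩, rfl⟩
  · exact LengthGE.comp (m := 0) (lengthGE_zero f)
      (LengthGE.comp (l := 0) (lengthGE_a e) (lengthGE_zero g))
  · exact LengthGE.comp (m := 0) (lengthGE_zero f)
      (LengthGE.comp (l := 0) (lengthGE_aStar e) (lengthGE_zero g))

theorem lengthGE_of_mem_arrowIdeal_pow {m : ℕ} : ∀ {p q : AVertex n} {f : obj k p ⟶ obj k q},
    f ∈ ((arrowIdeal k (Quiver.Symmetrify (AVertex n))).pow m).hom (obj k p) (obj k q) →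
    LengthGE m f := by
  induction m with
  | zero => exact fun _ => lengthGE_zero _
  | succ m ih =>
    intro p q f hf
    refine (Submodule.span_le (p := lengthSubmodule k n (m + 1) p q)).2 ?_ hf
    rintro _ ⟨x, f, g, hf, hg, rfl⟩
    exact (ih (q := x.as) hf).comp (lengthGE_of_mem_arrowIdeal (p := x.as) hg)

/-- From `d ≤ p - 1` and `d ≤ n - q` it follows that `2d + q - p ≤ n - 1`. -/
theorem LengthGE.eq_zero {p q : AVertex n} {f : obj k p ⟶ obj k q} (hf : LengthGE n f) :
    f = 0 :=
  ext_coeff fun d _ _ _ => by rw [hf d (by omega), map_zero]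

theorem a_mem_arrowIdeal {p q : AVertex n} (h : p.val + 1 = q.val) :
    a k h ∈ (arrowIdeal k (Quiver.Symmetrify (AVertex n))).hom (obj k p) (obj k q) :=
  Submodule.subset_span ⟨_, _, 𝟙 _, a k h, 𝟙 _,
    .mk (i := (⟨p, q, Sum.inl ⟨h⟩⟩ : Σ p q : Quiver.Symmetrify (AVertex n), p ⟶ q)), by simp⟩

theorem aStar_mem_arrowIdeal {p q : AVertex n} (h : p.val + 1 = q.val) :
    aStar k h ∈ (arrowIdeal k (Quiver.Symmetrify (AVertex n))).hom (obj k q) (obj k p) :=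
  Submodule.subset_span ⟨_, _, 𝟙 _, aStar k h, 𝟙 _,
    .mk (i := (⟨q, p, Sum.inr ⟨h⟩⟩ : Σ p q : Quiver.Symmetrify (AVertex n), p ⟶ q)), by simp⟩

/-- The `eqToHom` span is `k · 𝟙` for `p = q` and zero otherwise. Treating both cases together
allows an induction in which the target varies. -/
theorem mem_arrowIdeal_sup {p q : AVertex n} (f : obj k p ⟶ obj k q) :
    f ∈ (arrowIdeal k (Quiver.Symmetrify (AVertex n))).hom (obj k p) (obj k q) ⊔
      Submodule.span k {g | ∃ h : p = q, g = eqToHom (congrArg (obj k) h)} := by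
  induction f using hom_induction with
  | zero => exact Submodule.zero_mem _
  | add f g hf hg => exact Submodule.add_mem _ hf hg
  | smul x f hf => exact Submodule.smul_mem _ x hf
  | id => exact Submodule.mem_sup_right (Submodule.subset_span ⟨rfl, rfl⟩)
  | comp_a h f _ => exact Submodule.mem_sup_left (LinearIdeal.precomp _ f (a_mem_arrowIdeal h))
  | comp_aStar h f _ =>
    exact Submodule.mem_sup_left (LinearIdeal.precomp _ f (aStar_mem_arrowIdeal h))

theorem coeff_zero_id (p : AVertex n) : coeff 0 (𝟙 (obj k p)) = 1 := by
  have := p.one_le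
  have := p.le
  rw [(hasWeight_id p).coeff_eq (by omega) (by omega), coeff_one_zero]

theorem arrowIdeal_eq_top {p q : AVertex n} (h : p ≠ q) :
    (arrowIdeal k (Quiver.Symmetrify (AVertex n))).hom (obj k p) (obj k q) = ⊤ := by
  rw [eq_top_iff]
  intro f _
  have hf := mem_arrowIdeal_sup f
  have h0 : {g | ∃ h : p = q, g = eqToHom (congrArg (obj k) h)} = ∅ :=
    Set.eq_empty_of_forall_notMem fun _ hg => h hg.1
  rwa [h0, Submodule.span_empty, sup_bot_eq] at hf

theorem isCompl_arrowIdeal (p : AVertex n) : IsCompl (Submodule.span k {𝟙 (obj k p)})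
    ((arrowIdeal k (Quiver.Symmetrify (AVertex n))).hom (obj k p) (obj k p)) := by
  constructor
  · rw [Submodule.disjoint_def]
    intro f hf hf'
    obtain ⟨x, rfl⟩ := Submodule.mem_span_singleton.1 hf
    -- The coefficient in degree 0 is 1 on the identity and 0 on the arrow ideal.
    have := lengthGE_of_mem_arrowIdeal hf' 0 (by omega)
    rw [map_smul, coeff_zero_id, smul_eq_mul, mul_one] at this
    rw [this, zero_smul]
  · rw [codisjoint_iff, eq_top_iff, sup_comm]
    intro f _
    have hf := mem_arrowIdeal_sup f
    have h1 : {g | ∃ h : p = p, g = eqToHom (congrArg (obj k) h)} = {𝟙 (obj k p)} := by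
      ext g
      exact ⟨fun ⟨_, h⟩ => h, fun h => ⟨rfl, h⟩⟩
    rwa [h1] at hf

theorem isPseudoRadical_arrowIdeal :
    (arrowIdeal k (Quiver.Symmetrify (AVertex n))).IsPseudoRadical where
  isCompatibleComplement :=
    { retraction q := ⟨coeff (p := q.as) (q := q.as) 0, fun x => by
        have := coeff_zero_id (k := k) (p := q.as)
        refine (map_smul _ x _).trans ?_
        exact (congrArg (x • ·) this).trans (mul_one x)⟩
      isCompl q := isCompl_arrowIdeal (k := k) q.as
      comp_mem q f g _ hg := LinearIdeal.precomp _ f hg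
      comp_mem_of_ne p q h f g := by
        refine (arrowIdeal k (Quiver.Symmetrify (AVertex n))).postcomp g ?_
        have := arrowIdeal_eq_top (k := k) (p := p.as) (q := q.as)
          (fun h' => h (congrArg (obj k) h'))
        exact eq_top_iff.1 this Submodule.mem_top }
  eq_top_of_ne p q h := arrowIdeal_eq_top (k := k) (p := p.as) (q := q.as)
    (fun h' => h (congrArg (obj k) h'))

end MeshDoubleA

/-! ### Linear extension of functors to free linear categories. -/

section

variable (k : Type*) [CommRing k] {C D : Type*} [Category* C] [Category* D] [Preadditive D]
  [Linear k D]

/-- The action on morphisms of the linear extension of a functor. -/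
noncomputable def CategoryTheory.Free.extendHom (F : C ⥤ D) (X Y : Free k C) :
    (X ⟶ Y) →ₗ[k] (F.obj X ⟶ F.obj Y) :=
  Finsupp.linearCombination k (fun g : @Quiver.Hom C _ X Y => F.map g)

theorem CategoryTheory.Free.extendHom_single (F : C ⥤ D) {X Y : C} (f : X ⟶ Y) (r : k) :
    Free.extendHom k F X Y (Finsupp.single f r) = r • F.map f :=
  Finsupp.linearCombination_single k r f

@[elab_as_elim]
theorem CategoryTheory.Free.hom_induction {X Y : Free k C} {P : (X ⟶ Y) → Prop}
    (f : X ⟶ Y) (zero : P 0) (add : ∀ f g, P f → P g → P (f + g))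
    (single : ∀ (g : @Quiver.Hom C _ X Y) (r : k), P (Finsupp.single g r)) : P f :=
  Finsupp.induction_linear f zero add single

theorem CategoryTheory.Free.extendHom_comp (F : C ⥤ D) {X Y Z : Free k C} (f : X ⟶ Y)
    (g : Y ⟶ Z) :
    Free.extendHom k F X Z (f ≫ g) = Free.extendHom k F X Y f ≫ Free.extendHom k F Y Z g := by
  have map_comp_smul {X Y Z : C} (v : X ⟶ Y) (w : Y ⟶ Z) (r s : k) :
      (r * s) • F.map (v ≫ w) = (r • F.map v) ≫ (s • F.map w) := by
    rw [F.map_comp, Linear.smul_comp, Linear.comp_smul, mul_smul]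
  induction f using Free.hom_induction k with
  | zero => rw [Limits.zero_comp, map_zero, map_zero, Limits.zero_comp]
  | add f₁ f₂ h₁ h₂ =>
    rw [Preadditive.add_comp, map_add, map_add, Preadditive.add_comp, h₁, h₂]
  | single v r =>
    induction g using Free.hom_induction k with
    | zero => rw [Limits.comp_zero, map_zero, map_zero, Limits.comp_zero]
    | add f₁ f₂ h₁ h₂ =>
      rw [Preadditive.comp_add, map_add, map_add, Preadditive.comp_add, h₁, h₂]
    | single w s =>
      refine (congrArg _ (Free.single_comp_single k (C := C) v w r s)).trans
        ((Free.extendHom_single k F _ _).trans (.trans ?_ (congrArg₂ _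
          (Free.extendHom_single k F v r).symm (Free.extendHom_single k F w s).symm)))
      exact map_comp_smul v w r s

/-- The linear extension of a functor, without restrictions on the universes. -/
noncomputable def CategoryTheory.Free.extend (F : C ⥤ D) : Free k C ⥤ D where
  obj X := F.obj X
  map {X Y} f := Free.extendHom k F X Y f
  map_id _ := (Free.extendHom_single k F _ _).trans ((one_smul _ _).trans (F.map_id _))
  map_comp f g := Free.extendHom_comp k F f g

instance (F : C ⥤ D) : (Free.extend k F).Additive where
  map_add := map_add (Free.extendHom k F _ _) _ _

instance (F : C ⥤ D) : (Free.extend k F).Linear k where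
  map_smul f r := map_smul (Free.extendHom k F _ _) r f

end

/-! ### Construction and uniqueness of the Serre functor. -/

namespace MeshDoubleA

open AVertex

variable {k : Type w} [CommRing k] {n : ℕ}

theorem rev_rev (q : AVertex n) : q.rev.rev = q := by
  have := q.one_le
  have := q.le
  refine AVertex.ext ?_
  change n + 1 - (n + 1 - q.val) = q.val
  omega

theorem val_rev (q : AVertex n) : q.rev.val = n + 1 - q.val := rfl

/-- A linear functor on the mesh category is determined by its values on the arrows. -/
theorem functor_ext {S T : MeshDoubleA k n ⥤ MeshDoubleA k n} [S.Additive] [S.Linear k]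
    [T.Additive] [T.Linear k] (hobj : ∀ p : AVertex n, S.obj (obj k p) = T.obj (obj k p))
    (map_a : ∀ {p q : AVertex n} (h : p.val + 1 = q.val),
      S.map (a k h) = eqToHom (hobj p) ≫ T.map (a k h) ≫ eqToHom (hobj q).symm)
    (map_aStar : ∀ {p q : AVertex n} (h : p.val + 1 = q.val),
      S.map (aStar k h) = eqToHom (hobj q) ≫ T.map (aStar k h) ≫ eqToHom (hobj p).symm) :
    S = T := by
  have key {p q : AVertex n} (f : obj k p ⟶ obj k q) :
      S.map f = eqToHom (hobj p) ≫ T.map f ≫ eqToHom (hobj q).symm := by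
    induction f using hom_induction with
    | zero => simp
    | add f g hf hg => simp [hf, hg, S.map_add, T.map_add]
    | smul x f hf => simp [hf, S.map_smul, T.map_smul]
    | id => simp
    | comp_a h f hf => simp [hf, map_a]
    | comp_aStar h f hf => simp [hf, map_aStar]
  exact CategoryTheory.Functor.ext (fun X => hobj X.as) (fun X Y f => key (p := X.as) (q := Y.as) f)

variable (k n) in
/-- The Serre functor on the quiver. -/
noncomputable def serrePrefunctor : Quiver.Symmetrify (AVertex n) ⥤q MeshDoubleA k n where
  obj q := obj k (rev q)
  -- In terms of `b` the prescribed signs become uniform: `a ↦ (-1)^n b` and `b ↦ (-1)^n a`. The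
  -- second sign below also converts `(a_q)*` to `b`.
  map {p q} e := Sum.elim
    (fun e : PLift (AVertex.val p + 1 = AVertex.val q) => (-1 : k) ^ n • b k (rev_succ e.down))
    (fun e : PLift (AVertex.val q + 1 = AVertex.val p) =>
      (-1 : k) ^ (n + AVertex.val q) • a k (rev_succ e.down)) e

variable (k n) in
/-- The Serre functor on the path category. -/
noncomputable def serrePath : PathCategory k (Quiver.Symmetrify (AVertex n)) ⥤ MeshDoubleA k n :=
  Free.extend k (Paths.lift (serrePrefunctor k n))

instance : (serrePath k n).Additive := inferInstanceAs (Free.extend k _).Additive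

instance : (serrePath k n).Linear k := inferInstanceAs ((Free.extend k _).Linear k)

/-- The action of `serrePath` on morphisms. -/
noncomputable def serrePathMap {p q : AVertex n} :
    (pathVertex k p ⟶ pathVertex k q) →ₗ[k] (obj k p.rev ⟶ obj k q.rev) :=
  (serrePath k n).mapLinearMap k

theorem serrePathMap_comp {p q r : AVertex n} (f : pathVertex k p ⟶ pathVertex k q)
    (g : pathVertex k q ⟶ pathVertex k r) :
    serrePathMap (f ≫ g) = serrePathMap f ≫ serrePathMap g :=
  (serrePath k n).map_comp f g

theorem serrePath_map_pathArrow {p q : Quiver.Symmetrify (AVertex n)} (e : p ⟶ q) :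
    (serrePath k n).map (pathArrow k e) = (serrePrefunctor k n).map e :=
  (Free.extendHom_single k _ _ _).trans ((one_smul _ _).trans (Category.id_comp _))

theorem serrePathMap_pathA {p q : AVertex n} (h : p.val + 1 = q.val) :
    serrePathMap (pathA k h) = (-1 : k) ^ n • b k (rev_succ h) :=
  serrePath_map_pathArrow _

theorem serrePathMap_pathAStar {p q : AVertex n} (h : p.val + 1 = q.val) :
    serrePathMap (pathAStar k h) = (-1 : k) ^ (n + p.val) • a k (rev_succ h) :=
  serrePath_map_pathArrow _

/-- Exchanging `a` with `b` and `q` with `n + 1 - q` preserves the commutation relations and swaps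
the zero relations at 1 and `n`. -/
theorem serrePathMap_mesh (q : AVertex n) : serrePathMap (mesh k q) = 0 := by
  rw [mesh_eq, map_add]
  have h1 := q.one_le
  have hn := q.le
  have val_q := val_rev q
  by_cases hq : 1 < q.val <;> by_cases hq' : q.val < n
  · rw [dif_pos hq, dif_pos hq', serrePathMap_comp, serrePathMap_comp, serrePathMap_pathA,
      serrePathMap_pathA, serrePathMap_pathAStar, serrePathMap_pathAStar, Linear.smul_comp,
      Linear.comp_smul, Linear.smul_comp, Linear.comp_smul,
      b_comp_a _ (rev_succ (q.pred_succ hq)), ← pred_succ q hq, smul_smul, smul_smul, ← add_smul]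
    convert zero_smul k _
    ring
  · rw [dif_pos hq, dif_neg hq', map_zero, add_zero, serrePathMap_comp, serrePathMap_pathA,
      serrePathMap_pathAStar, Linear.smul_comp, Linear.comp_smul,
      a_comp_b_eq_zero _ (by omega), smul_zero, smul_zero]
  · rw [dif_neg hq, dif_pos hq', map_zero, zero_add, serrePathMap_comp, serrePathMap_pathA,
      serrePathMap_pathAStar, Linear.smul_comp, Linear.comp_smul,
      b_comp_a_eq_zero _ (by omega), smul_zero, smul_zero]
  · rw [dif_neg hq, dif_neg hq', map_zero, add_zero]

theorem serrePath_map_eq_zero {X Y : PathCategory k (Quiver.Symmetrify (AVertex n))} {f : X ⟶ Y}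
    (hf : f ∈ (meshIdeal k (Quiver.Symmetrify (AVertex n))).hom X Y) :
    (serrePath k n).map f = 0 := by
  refine (Submodule.span_le (p := LinearMap.ker ((serrePath k n).mapLinearMap k))).2 ?_ hf
  rintro _ ⟨x, y, f, s, g, ⟨q⟩, rfl⟩
  change (serrePath k n).map (f ≫ _ ≫ g) = 0
  rw [Functor.map_comp, Functor.map_comp]
  have := serrePathMap_mesh (k := k) (n := n) q
  change (serrePath k n).map (meshRelation k (V := Quiver.Symmetrify (AVertex n)) q) = 0 at this
  erw [this]
  rw [Limits.zero_comp, Limits.comp_zero]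

variable (k n) in
/-- The Serre functor of the mesh category. -/
noncomputable def serre : MeshDoubleA k n ⥤ MeshDoubleA k n :=
  CategoryTheory.Quotient.lift _ (serrePath k n) fun _ _ f g h => by
    rw [← sub_eq_zero, ← Functor.map_sub]
    exact serrePath_map_eq_zero h

instance : (serre k n).Additive where
  map_add {X Y} := by
    rintro ⟨f⟩ ⟨g⟩
    exact (serrePath k n).map_add (f := f) (g := g)

instance : (serre k n).Linear k where
  map_smul {X Y} := by
    rintro ⟨f⟩ r
    exact (serrePath k n).map_smul r f

/-- The action of the Serre functor on morphisms. -/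
noncomputable def serreMap {p q : AVertex n} :
    (obj k p ⟶ obj k q) →ₗ[k] (obj k p.rev ⟶ obj k q.rev) :=
  (serre k n).mapLinearMap k

theorem serreMap_comp {p q r : AVertex n} (f : obj k p ⟶ obj k q) (g : obj k q ⟶ obj k r) :
    serreMap (f ≫ g) = serreMap f ≫ serreMap g :=
  (serre k n).map_comp f g

theorem serreMap_id (p : AVertex n) : serreMap (𝟙 (obj k p)) = 𝟙 (obj k p.rev) :=
  (serre k n).map_id _

theorem serreMap_a {p q : AVertex n} (h : p.val + 1 = q.val) :
    serreMap (a k h) = (-1 : k) ^ n • b k (rev_succ h) :=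
  serrePathMap_pathA h

theorem serreMap_aStar {p q : AVertex n} (h : p.val + 1 = q.val) :
    serreMap (aStar k h) = (-1 : k) ^ (n + p.val) • a k (rev_succ h) :=
  serrePathMap_pathAStar h

theorem serreMap_b {p q : AVertex n} (h : p.val + 1 = q.val) :
    serreMap (b k h) = (-1 : k) ^ n • a k (rev_succ h) := by
  rw [b, map_smul, serreMap_aStar, smul_smul]
  congr 1
  rw [pow_add, mul_left_comm, ← mul_pow, neg_one_mul, neg_neg, one_pow, mul_one]

theorem serreFormulae_serre : SerreFormulae k (serre k n) where
  obj_eq _ := rfl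
  map_a {p q} h := by
    have hq := q.le
    refine (serreMap_a h).trans (.trans ?_ ((Category.id_comp _).trans (Category.comp_id _)).symm)
    rw [b, smul_smul]
    congr 1
    rw [← pow_add, neg_one_pow_eq_pow_mod_two, neg_one_pow_eq_pow_mod_two (n := p.val), val_rev]
    congr 1
    omega
  map_aStar {p q} h := by
    have hq := q.le
    refine (serreMap_aStar h).trans (.trans ?_ ((Category.id_comp _).trans (Category.comp_id _)).symm)
    congr 1
    rw [neg_one_pow_eq_pow_mod_two, neg_one_pow_eq_pow_mod_two (n := n - p.val)]
    congr 1
    omega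

theorem SerreFormulae.eq {S T : MeshDoubleA k n ⥤ MeshDoubleA k n} [S.Additive] [S.Linear k]
    [T.Additive] [T.Linear k] (hS : SerreFormulae k S) (hT : SerreFormulae k T) : S = T :=
  functor_ext (fun p => (hS.obj_eq p).trans (hT.obj_eq p).symm)
    (fun h => by rw [hS.map_a, hT.map_a]; simp) (fun h => by rw [hS.map_aStar, hT.map_aStar]; simp)

theorem eqToHom_comp_a {p q p' q' : AVertex n} (hp : p = p') (hq : q = q')
    (h : p.val + 1 = q.val) (h' : p'.val + 1 = q'.val) :
    a k h = eqToHom (congrArg (obj k) hp) ≫ a k h' ≫ eqToHom (congrArg (obj k) hq.symm) := by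
  subst hp hq
  simp

theorem eqToHom_comp_b {p q p' q' : AVertex n} (hp : p = p') (hq : q = q')
    (h : p.val + 1 = q.val) (h' : p'.val + 1 = q'.val) :
    b k h = eqToHom (congrArg (obj k) hq) ≫ b k h' ≫ eqToHom (congrArg (obj k) hp.symm) := by
  subst hp hq
  simp

theorem serreMap_serreMap_a {p q : AVertex n} (h : p.val + 1 = q.val) :
    serreMap (serreMap (a k h)) = a k (rev_succ (rev_succ h)) := by
  rw [serreMap_a, map_smul, serreMap_b, smul_smul, ← mul_pow, neg_one_mul, neg_neg, one_pow,
    one_smul]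

theorem serreMap_serreMap_b {p q : AVertex n} (h : p.val + 1 = q.val) :
    serreMap (serreMap (b k h)) = b k (rev_succ (rev_succ h)) := by
  rw [serreMap_b, map_smul, serreMap_a, smul_smul, ← mul_pow, neg_one_mul, neg_neg, one_pow,
    one_smul]

/-- On arrows the two signs `(-1)^n` multiply to 1, so the functor is its own inverse. -/
theorem serre_comp_serre : serre k n ⋙ serre k n = 𝟭 _ :=
  functor_ext (fun p => congrArg (obj k) (rev_rev p))
    (fun {p q} h => (serreMap_serreMap_a h).trans
      (eqToHom_comp_a (rev_rev p) (rev_rev q) _ h))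
    (fun {p q} h => by
      refine (congrArg (fun f => serreMap (serreMap f)) (aStar_eq h)).trans ?_
      rw [map_smul, map_smul, serreMap_serreMap_b,
        eqToHom_comp_b (rev_rev p) (rev_rev q) _ h, Functor.id_map, aStar_eq h, Linear.smul_comp,
        Linear.comp_smul]
      rfl)

theorem isEquivalence_serre : (serre k n).IsEquivalence :=
  (CategoryTheory.Equivalence.mk (serre k n) (serre k n) (eqToIso serre_comp_serre.symm)
    (eqToIso serre_comp_serre)).isEquivalence_functor

end MeshDoubleA

/-! ### Serre duality. -/

namespace MeshDoubleA

open AVertex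

variable {k : Type w} [CommRing k] {n : ℕ}

theorem normalPath_zero_eq_a {p q : AVertex n} (h : p.val + 1 = q.val) :
    normalPath k p q 0 = a k h := by
  rw [← normalPath_comp_a le_rfl h, normalPath_self_zero, Category.id_comp]

theorem normalPath_one_eq_b {p q : AVertex n} (h : p.val + 1 = q.val) :
    normalPath k q p 1 = b k h := by
  rw [← zero_add 1, ← normalPath_comp_b le_rfl h, normalPath_self_zero, Category.id_comp]

variable (k) in
/-- The linear form on `Q(p, n + 1 - p)` that induces the Serre duality pairing. -/
noncomputable def trace (p : AVertex n) : (obj k p ⟶ obj k p.rev) →ₗ[k] k :=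
  -- Degree `p - 1` is the highest one on `Q(p, n + 1 - p)`. The sign absorbs the factor `(-1)^n` of
  -- the Serre functor when `p` changes by one.
  (-1 : k) ^ (n * p.val) • coeff (p.val - 1)

theorem trace_apply (p : AVertex n) (f : obj k p ⟶ obj k p.rev) :
    trace k p f = (-1) ^ (n * p.val) * coeff (p.val - 1) f := rfl

/-- Both sides pick out the coefficient of `g` in degree `p - 1`: `a` does not shift degrees, and
`b` shifts by one to the top degree `q - 1`. -/
theorem trace_a_comp {p q : AVertex n} (h : p.val + 1 = q.val) (g : obj k q ⟶ obj k p.rev) :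
    trace k p (a k h ≫ g) = trace k q (g ≫ serreMap (a k h)) := by
  have := p.one_le
  have := q.le
  have := val_rev p
  have := val_rev q
  have h₁ := coeff_normalPath_comp (d := p.val - 1) (e := 0) (by omega) (by omega) (by omega) g
    (p := p)
  have h₂ := coeff_comp_normalPath (d := p.val - 1) (e := 1) (by omega) (by omega) (by omega) g
    (r := q.rev)
  rw [normalPath_zero_eq_a h, zero_add] at h₁
  rw [normalPath_one_eq_b (rev_succ h), show p.val - 1 + 1 = q.val - 1 by omega] at h₂
  rw [trace_apply, trace_apply, h₁, serreMap_a, Linear.comp_smul, map_smul, h₂, ← h, smul_eq_mul,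
    ← mul_assoc, ← pow_add]
  congr 1
  rw [show n * (p.val + 1) + n = n * p.val + (n + n) by ring, pow_add _ _ (n + n), pow_add _ n,
    ← mul_pow, neg_one_mul, neg_neg, one_pow, mul_one]

theorem trace_b_comp {p q : AVertex n} (h : p.val + 1 = q.val) (g : obj k p ⟶ obj k q.rev) :
    trace k q (b k h ≫ g) = trace k p (g ≫ serreMap (b k h)) := by
  have := p.one_le
  have := q.le
  have := val_rev p
  have := val_rev q
  have h₁ := coeff_normalPath_comp (d := p.val - 1) (e := 1) (by omega) (by omega) (by omega) g
    (p := q)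
  have h₂ := coeff_comp_normalPath (d := p.val - 1) (e := 0) (by omega) (by omega) (by omega) g
    (r := p.rev)
  rw [normalPath_one_eq_b h, show 1 + (p.val - 1) = q.val - 1 by omega] at h₁
  rw [normalPath_zero_eq_a (rev_succ h), add_zero] at h₂
  rw [trace_apply, trace_apply, h₁, serreMap_b, Linear.comp_smul, map_smul, h₂, ← h, smul_eq_mul,
    ← mul_assoc, ← pow_add, mul_add, mul_one]

/-- This twisted symmetry passes from arrows to composites by moving one factor around at a time; it
gives naturality in the first variable. -/
theorem trace_comp {p q : AVertex n} (f : obj k p ⟶ obj k q) (g : obj k q ⟶ obj k p.rev) :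
    trace k p (f ≫ g) = trace k q (g ≫ serreMap f) := by
  induction f using hom_induction with
  | zero => simp
  | add f₁ f₂ h₁ h₂ => simp [Preadditive.add_comp, Preadditive.comp_add, h₁, h₂]
  | smul x f hf => simp [hf]
  | id => rw [serreMap_id, Category.id_comp, Category.comp_id]
  | comp_a h f hf =>
    rw [serreMap_comp, Category.assoc, hf, Category.assoc, trace_a_comp, Category.assoc]
  | comp_aStar h f hf =>
    rw [aStar_eq, Linear.comp_smul, Linear.smul_comp, map_smul, map_smul, Linear.comp_smul,
      map_smul, serreMap_comp, Category.assoc, hf, Category.assoc, trace_b_comp, Category.assoc]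

variable (k) in
/-- The Serre duality pairing. -/
noncomputable def serrePairing (p q : AVertex n) :
    (obj k p ⟶ obj k q) →ₗ[k] Module.Dual k (obj k q ⟶ obj k p.rev) :=
  (Linear.comp (S := k) (obj k p) (obj k q) (obj k p.rev)).compr₂ (trace k p)

theorem serrePairing_apply (p q : AVertex n) (f : obj k p ⟶ obj k q)
    (g : obj k q ⟶ obj k p.rev) : serrePairing k p q f g = trace k p (f ≫ g) := rfl

theorem neg_one_pow_mul_self_mul (m : ℕ) (x : k) : (-1) ^ m * ((-1) ^ m * x) = x := by
  rw [← mul_assoc, ← mul_pow, neg_one_mul, neg_neg, one_pow, one_mul]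

theorem serrePairing_injective (p q : AVertex n) : Function.Injective (serrePairing k p q) := by
  rw [injective_iff_map_eq_zero]
  intro f hf
  refine ext_coeff fun d h₁ h₂ h₃ => ?_
  have := p.le
  have := q.le
  have := val_rev p
  -- Pairing with the normal form of complementary degree isolates the coefficient of `f` in degree
  -- `d`.
  have h := LinearMap.congr_fun hf (normalPath k q p.rev (p.val - 1 - d))
  rw [serrePairing_apply, trace_apply] at h
  have h' := coeff_comp_normalPath (d := d) (e := p.val - 1 - d) (by omega) (by omega) (by omega) f
    (r := p.rev)
  rw [show d + (p.val - 1 - d) = p.val - 1 by omega] at h'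
  rw [← h', map_zero, ← neg_one_pow_mul_self_mul (n * p.val) (coeff _ _), h, LinearMap.zero_apply,
    mul_zero]

theorem serrePairing_surjective (p q : AVertex n) : Function.Surjective (serrePairing k p q) := by
  intro ψ
  -- The preimage is the expansion of `ψ` in the dual basis; the sign cancels that of the trace.
  refine ⟨(-1 : k) ^ (n * p.val) • ∑ e ∈ Finset.range n,
    ψ (normalPath k q p.rev e) • normalPath k p q (p.val - 1 - e), ?_⟩
  ext g
  have := p.le
  have := p.one_le
  have := val_rev p
  rw [serrePairing_apply, trace_apply, Linear.smul_comp, map_smul, smul_eq_mul,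
    neg_one_pow_mul_self_mul, Preadditive.sum_comp, map_sum]
  conv_rhs => rw [← sum_coeff_smul_normalPath g, map_sum]
  refine Finset.sum_congr rfl fun e _ => ?_
  rw [Linear.smul_comp, map_smul, map_smul, smul_eq_mul, smul_eq_mul, mul_comm]
  rcases le_or_gt p.val e with he | he
  -- For `e ≥ p` the subtraction `p - 1 - e` truncates, but `ψ` is evaluated at a vanishing normal
  -- form.
  · rw [normalPath_of_le_target (q := p.rev) (by omega), map_zero, mul_zero, mul_zero]
  congr 1
  rcases le_or_gt q.val e with hq | hq
  · rw [normalPath_of_lt (by omega), Limits.zero_comp, map_zero, coeff_of_le (by omega)]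
  · rw [← coeff_normalPath_comp (p := p) (e := p.val - 1 - e) (d := e) (by omega) (by omega)
      (by omega), Nat.sub_add_cancel (by omega)]

theorem isSerreFunctor_serre : IsSerreFunctor k (serre k n) where
  additive := inferInstance
  linear := inferInstance
  isEquivalence := isEquivalence_serre
  exists_natural_iso := by
    refine ⟨fun p q => LinearEquiv.ofBijective (serrePairing k p.as q.as)
      ⟨serrePairing_injective _ _, serrePairing_surjective _ _⟩, ?_, ?_⟩
    · intro p q q' f β g
      exact congrArg (trace k p.as) (Category.assoc f β g)
    · intro p' p q α f g
      refine (congrArg (trace k p'.as) (Category.assoc α f g)).trans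
        ((trace_comp (p := p'.as) (q := p.as) α (f ≫ g)).trans ?_)
      exact congrArg (trace k p.as) (Category.assoc f g _)

theorem isHomFinite : IsHomFinite k (MeshDoubleA k n) := fun p q =>
  ⟨.of_basis (basis k p.as q.as), .of_basis (basis k p.as q.as)⟩

instance : Finite (MeshDoubleA k n) :=
  Finite.of_surjective (obj k (n := n)) fun X => ⟨X.as, rfl⟩

theorem isLocallyBounded : IsLocallyBounded (MeshDoubleA k n) := fun _ =>
  ⟨Set.toFinite _, Set.toFinite _⟩

end MeshDoubleA

theorem theorem7p9 (k : Type*) [CommRing k] (n : ℕ) (hn : 2 ≤ n) :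
    IsHomFinite k (MeshDoubleA k n) ∧
    IsLocallyBounded (MeshDoubleA k n) ∧
    (∀ p q : AVertex n, Nonempty (Module.Basis
      (Fin (min (min p.val q.val) (min (n + 1 - p.val) (n + 1 - q.val)))) k
      (MeshDoubleA.obj k p ⟶ MeshDoubleA.obj k q))) ∧
    (∃ S : MeshDoubleA k n ⥤ MeshDoubleA k n,
      IsSerreFunctor k S ∧ MeshDoubleA.SerreFormulae k S ∧
      ∀ T : MeshDoubleA k n ⥤ MeshDoubleA k n,
        T.Additive → T.Linear k → MeshDoubleA.SerreFormulae k T → T = S) ∧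
    StrongRetractionProperty k (MeshDoubleA k n) ∧
    (arrowIdeal k (Quiver.Symmetrify (AVertex n))).IsPseudoRadical ∧
    (∀ p q : MeshDoubleA k n,
      ((arrowIdeal k (Quiver.Symmetrify (AVertex n))).pow n).hom p q = ⊥) := by
  refine ⟨MeshDoubleA.isHomFinite, MeshDoubleA.isLocallyBounded,
    fun p q => ⟨MeshDoubleA.basis k p q⟩,
    ⟨MeshDoubleA.serre k n, MeshDoubleA.isSerreFunctor_serre, MeshDoubleA.serreFormulae_serre,
      fun T _ _ hT => hT.eq MeshDoubleA.serreFormulae_serre⟩,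
    ⟨_, MeshDoubleA.isPseudoRadical_arrowIdeal.isCompatibleComplement⟩,
    MeshDoubleA.isPseudoRadical_arrowIdeal, fun p q => ?_⟩
  rw [eq_bot_iff]
  intro f hf
  exact (MeshDoubleA.lengthGE_of_mem_arrowIdeal_pow (p := p.as) (q := q.as) hf).eq_zero
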